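/- Let $G$ be a locally compact (Hausdorff) group with a fixed left Haar measure $dx$, and let $A$ be a complex Banach algebra with a contractive approximate identity; $M(A)$ denotes its multiplier (double centralizer) algebra. A \emph{twisted action} $(\alpha,\sigma)$ of $G$ on $A$ consists of isometric algebra automorphisms $\alpha_x$ of $A$ ($x\in G$) and invertible $\sigma_{x,y}\in M(A)$ with $\|\sigma_{x,y}\|=\|\sigma_{x,y}^{-1}\|=1$ ($x,y\in G$) such that, for all $a\in A$, the maps $x\mapsto\alpha_x(a)$, $(x,y)\mapsto\sigma_{x,y}a$ and $(x,y)\mapsto a\sigma_{x,y}$ are continuous, $\alpha_1=\mathrm{id}_A$, $\sigma_{1,x}=\sigma_{x,1}=1$, $\alpha_x(\alpha_y(a))=\sigma_{x,y}\,\alpha_{xy}(a)\,\sigma_{x,y}^{-1}$ and $\alpha_z(\sigma_{x,y})\sigma_{z,xy}=\sigma_{z,x}\sigma_{zx,y}$ for all $x,y,z\in G$, where $\alpha_z$ also denotes its extension to $M(A)$. Let $L^1(G,A,\alpha,\sigma)$ be $L^1(G;A)$ with the twisted convolution $$(f*g)(x)=\int_G f(y)\,\alpha_y(g(y^{-1}x))\,\sigma_{y,y^{-1}x}\,dy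 .$$ A \emph{covariant representation} $(\pi,u)$ on a complex Banach space $E$ consists of a bounded nondegenerate algebra homomorphism $\pi:A\to\mathcal B(E)$ (the span of $\pi(A)E$ is dense) and a strongly continuous map $u$ from $G$ to the invertible isometries of $E$ such that $u_xu_y=\widehat\pi(\sigma_{x,y})u_{xy}$ and $\pi(\alpha_x(a))=u_x\pi(a)u_x^{-1}$ for all $x,y\in G$, $a\in A$, where $\widehat\pi:M(A)\to\mathcal B(E)$ is the unique unital extension of $\pi$. Its integrated form is $(\pi\rtimes u)(f)=\int_G\pi(f(x))u_x\,dx$ (strong integral), $f\in L^1(G;A)$. Let $\mathcal R$ be a nonempty class of covariant representations that is uniformly bounded, that is, $C_{\mathcal R}:=\sup\{\|\pi\|:(\pi,u)\in\mathcal R\}<\infty$. Let $F_{\mathcal R}(G,A,\alpha,\sigma)$ be the Hausdorff completion of $L^1(G,A,\alpha,\sigma)$ with respect to the seminorm $\|f\|_{\mathcal R}=\sup\{\|(\pi\rtimes u)(f)\|:(\pi,u)\in\mathcal R\}$, with the multiplication extending the twisted convolution by continuity. Then the twisted convolution is well defined on $L^1(G;A)$ (for $f,g\in L^1(G;A)$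 the integral defining $(f*g)(x)$ converges absolutely for almost every $x$, and $f*g$ is integrable), its extension by continuity makes $F_{\mathcal R}(G,A,\alpha,\sigma)$ a Banach algebra, and this Banach algebra has a $C_{\mathcal R}$-bounded approximate identity: there is a net $(e_\lambda)$ in $F_{\mathcal R}(G,A,\alpha,\sigma)$ with $\|e_\lambda\|\le C_{\mathcal R}$ for all $\lambda$ and $\|e_\lambda c-c\|\to0$ and $\|c\,e_\lambda-c\|\to0$ for every $c\in F_{\mathcal R}(G,A,\alpha,\sigma)$. -/

import Mathlib

open MeasureTheory Filter Topology
open scoped MultiplierAlgebra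

set_option linter.unusedSectionVars false

noncomputable section

namespace TwistedCP

universe u uG uA uE

/-- `B` has a `C`-bounded (two-sided) approximate identity: a net in `B` of elements of norm at
most `C` with `‖e_l b - b‖ → 0` and `‖b e_l - b‖ → 0` for every `b`. -/
def HasBoundedApproxIdentity (B : Type u) [SeminormedAddCommGroup B] [Mul B] (C : ℝ) : Prop :=
  ∃ (Λ : Type u) (_ : Preorder Λ) (_ : IsDirected Λ (· ≤ ·)) (_ : Nonempty Λ) (e : Λ → B),
    (∀ l, ‖e l‖ ≤ C) ∧
    ∀ b : B, Tendsto (fun l => ‖e l * b - b‖) atTop (𝓝 0) ∧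
      Tendsto (fun l => ‖b * e l - b‖) atTop (𝓝 0)

section Algebra

variable (A : Type uA) [NonUnitalNormedRing A] [NormedSpace ℂ A]

/-- `A` has a contractive approximate identity (cai). -/
class HasCAI : Prop where
  exists_cai : HasBoundedApproxIdentity A 1

end Algebra

section Multipliers

variable {A : Type uA} [NonUnitalNormedRing A] [NormedSpace ℂ A] [SMulCommClass ℂ A A]
  [IsScalarTower ℂ A A]

/-- The extension of an isometric automorphism `φ` of `A` to the multiplier algebra:
`(L, R) ↦ (φ L φ⁻¹, φ R φ⁻¹)`. -/
def liftAut (φ : A ≃ₗᵢ[ℂ] A) (hφ : ∀ a b, φ (a * b) = φ a * φ b) (t : 𝓜(ℂ, A)) : 𝓜(ℂ, A) where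
  fst := (φ : A →L[ℂ] A).comp (t.fst.comp (φ.symm : A →L[ℂ] A))
  snd := (φ : A →L[ℂ] A).comp (t.snd.comp (φ.symm : A →L[ℂ] A))
  central := fun x y => by
    have h := congrArg φ (t.central (φ.symm x) (φ.symm y))
    simpa [hφ] using h

/-- The defining property of `liftAut`: `φ(t) φ(a) = φ(t a)` and `φ(a) φ(t) = φ(a t)`. -/
theorem liftAut_spec (φ : A ≃ₗᵢ[ℂ] A) (hφ : ∀ a b, φ (a * b) = φ a * φ b) (t : 𝓜(ℂ, A)) (a : A) :
    (liftAut φ hφ t).fst (φ a) = φ (t.fst a) ∧ (liftAut φ hφ t).snd (φ a) = φ (t.snd a) := by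
  simp [liftAut]

variable {E : Type uE} [NormedAddCommGroup E] [NormedSpace ℂ E]

/-- A representation `π` of `A` on `E` is nondegenerate if the span of all `π(a)ξ` is dense. -/
def Nondegenerate (π : A →L[ℂ] (E →L[ℂ] E)) : Prop :=
  Dense (Submodule.span ℂ {η : E | ∃ (a : A) (ξ : E), η = π a ξ} : Set E)

theorem Nondegenerate.ext {π : A →L[ℂ] (E →L[ℂ] E)} (hn : Nondegenerate π) {S T : E →L[ℂ] E}
    (h : ∀ a ξ, S (π a ξ) = T (π a ξ)) : S = T := by
  refine ContinuousLinearMap.ext_on hn ?_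
  rintro _ ⟨a, ξ, rfl⟩
  exact h a ξ

theorem fst_mul_apply [HasCAI A] (m : 𝓜(ℂ, A)) (a b : A) : m.fst (a * b) = m.fst a * b := by
  obtain ⟨Λ, _, _, _, e, -, h⟩ := HasCAI.exists_cai (A := A)
  have key : ∀ x : A, x * m.fst (a * b) = x * (m.fst a * b) := fun x => by
    rw [← m.central, ← mul_assoc, ← mul_assoc, ← m.central]
  have h1 := tendsto_iff_norm_sub_tendsto_zero.2 (h (m.fst (a * b))).1
  have h2 := tendsto_iff_norm_sub_tendsto_zero.2 (h (m.fst a * b)).1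
  simp only [key] at h1
  exact tendsto_nhds_unique h1 h2

theorem snd_mul_apply [HasCAI A] (m : 𝓜(ℂ, A)) (a b : A) : m.snd (a * b) = a * m.snd b := by
  obtain ⟨Λ, _, _, _, e, -, h⟩ := HasCAI.exists_cai (A := A)
  have key : ∀ x : A, m.snd (a * b) * x = (a * m.snd b) * x := fun x => by
    rw [m.central, mul_assoc, mul_assoc, m.central]
  have h1 := tendsto_iff_norm_sub_tendsto_zero.2 (h (m.snd (a * b))).2
  have h2 := tendsto_iff_norm_sub_tendsto_zero.2 (h (a * m.snd b)).2
  simp only [key] at h1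
  exact tendsto_nhds_unique h1 h2

theorem exists_extension [HasCAI A] [CompleteSpace E] (π : A →L[ℂ] (E →L[ℂ] E))
    (hπ : ∀ a b, π (a * b) = π a * π b) (hn : Nondegenerate π) (m : 𝓜(ℂ, A)) :
    ∃ T : E →L[ℂ] E, ∀ a ξ, T (π a ξ) = π (m.fst a) ξ := by
  let p : ((A × E) →₀ ℂ) →ₗ[ℂ] E := Finsupp.linearCombination ℂ (fun q : A × E => π q.1 q.2)
  let f : ((A × E) →₀ ℂ) →ₗ[ℂ] E :=
    Finsupp.linearCombination ℂ (fun q : A × E => π (m.fst q.1) q.2)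
  have hrange : (Set.range fun q : A × E => π q.1 q.2) = {η : E | ∃ a ξ, η = π a ξ} := by
    ext η
    simp [eq_comm]
  have hd : DenseRange p := by
    have : Set.range p = (LinearMap.range p : Set E) := (LinearMap.coe_range p).symm
    rw [DenseRange, this, Finsupp.range_linearCombination, hrange]
    exact hn
  obtain ⟨Λ, _, _, _, e, he, h⟩ := HasCAI.exists_cai (A := A)
  have hconv : ∀ v, Tendsto (fun l => π (m.fst (e l)) (p v)) atTop (𝓝 (f v)) := by
    intro v
    induction v using Finsupp.induction_linear with
    | zero => simp
    | add v w hv hw => simpa using hv.add hw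
    | single q c =>
      have h1 : Tendsto (fun l => e l * q.1) atTop (𝓝 q.1) :=
        tendsto_iff_norm_sub_tendsto_zero.2 (h q.1).1
      have h2 : Tendsto (fun l => c • π (m.fst (e l * q.1)) q.2) atTop
          (𝓝 (c • π (m.fst q.1) q.2)) := by
        have hc : Continuous fun a : A => c • π (m.fst a) q.2 := by fun_prop
        exact (hc.tendsto _).comp h1
      simpa [p, f, fst_mul_apply, hπ] using h2
  have hb : ∀ v, ‖f v‖ ≤ (‖π‖ * ‖m.fst‖) * ‖p v‖ := by
    intro v
    refine le_of_tendsto (hconv v).norm (Eventually.of_forall fun l => ?_)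
    calc ‖π (m.fst (e l)) (p v)‖ ≤ ‖π (m.fst (e l))‖ * ‖p v‖ := (π _).le_opNorm _
      _ ≤ (‖π‖ * ‖m.fst (e l)‖) * ‖p v‖ := by gcongr; exact π.le_opNorm _
      _ ≤ (‖π‖ * (‖m.fst‖ * 1)) * ‖p v‖ := by
          gcongr
          exact (m.fst.le_opNorm _).trans (by gcongr; exact he l)
      _ = _ := by ring
  refine ⟨f.extendOfNorm p, fun a ξ => ?_⟩
  have := LinearMap.extendOfNorm_eq (f := f) (e := p) hd ⟨_, hb⟩ (Finsupp.single (a, ξ) 1)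
  simpa [p, f] using this

/-- The unique unital extension `π̂ : M(A) → B(E)` of a nondegenerate representation
`π : A → B(E)`; it satisfies `π̂(m) π(a) = π(m a)` and `π̂ ∘ ι_A = π`. -/
def hatRep [HasCAI A] [CompleteSpace E] (π : A →L[ℂ] (E →L[ℂ] E))
    (hπ : ∀ a b, π (a * b) = π a * π b) (hn : Nondegenerate π) :
    𝓜(ℂ, A) →ₐ[ℂ] (E →L[ℂ] E) :=
  have spec := fun m => (exists_extension π hπ hn m).choose_spec
  AlgHom.ofLinearMap
    { toFun := fun m => (exists_extension π hπ hn m).choose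
      map_add' := fun m n => hn.ext fun a ξ => by
        rw [add_apply, spec, spec, spec]
        simp
      map_smul' := fun c m => hn.ext fun a ξ => by
        rw [smul_apply, spec, spec]
        simp }
    (hn.ext fun a ξ => (spec 1 a ξ).trans (by simp))
    (fun m n => hn.ext fun a ξ => (spec (m * n) a ξ).trans (by
      change _ = (exists_extension π hπ hn m).choose ((exists_extension π hπ hn n).choose (π a ξ))
      rw [spec, spec]
      simp))

theorem hatRep_apply [HasCAI A] [CompleteSpace E] (π : A →L[ℂ] (E →L[ℂ] E))
    (hπ : ∀ a b, π (a * b) = π a * π b) (hn : Nondegenerate π) (m : 𝓜(ℂ, A)) (a : A) (ξ : E) :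
    hatRep π hπ hn m (π a ξ) = π (m.fst a) ξ :=
  (exists_extension π hπ hn m).choose_spec a ξ

theorem hatRep_coe [HasCAI A] [CompleteSpace E] (π : A →L[ℂ] (E →L[ℂ] E))
    (hπ : ∀ a b, π (a * b) = π a * π b) (hn : Nondegenerate π) (a : A) :
    hatRep π hπ hn (a : 𝓜(ℂ, A)) = π a :=
  hn.ext fun b ξ => by simp [hatRep_apply, hπ]

end Multipliers

/-- A twisted action `(α, σ)` of `G` on `A`: the maps `α_x` are isometric algebra automorphisms,
`σ_{x,y}` are invertible multipliers with `‖σ_{x,y}‖ = ‖σ_{x,y}⁻¹‖ = 1`. For a multiplier `t`, the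
products `t a` and `a t` are `t.fst a` and `t.snd a`. -/
structure TwistedAction (G : Type uG) [Group G] [TopologicalSpace G]
    (A : Type uA) [NonUnitalNormedRing A] [NormedSpace ℂ A] [SMulCommClass ℂ A A]
    [IsScalarTower ℂ A A] where
  /-- the maps `α_x` -/
  α : G → (A ≃ₗᵢ[ℂ] A)
  α_mul : ∀ x a b, α x (a * b) = α x a * α x b
  /-- the twist `σ_{x,y}` -/
  σ : G → G → (𝓜(ℂ, A))ˣ
  norm_σ : ∀ x y, ‖(σ x y : 𝓜(ℂ, A))‖ = 1
  norm_σ_inv : ∀ x y, ‖((σ x y)⁻¹ : (𝓜(ℂ, A))ˣ).val‖ = 1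
  continuous_α : ∀ a, Continuous fun x => α x a
  continuous_σ_left : ∀ a, Continuous fun p : G × G => (σ p.1 p.2 : 𝓜(ℂ, A)).fst a
  continuous_σ_right : ∀ a, Continuous fun p : G × G => (σ p.1 p.2 : 𝓜(ℂ, A)).snd a
  α_one : ∀ a, α 1 a = a
  σ_one_left : ∀ x, σ 1 x = 1
  σ_one_right : ∀ x, σ x 1 = 1
  /-- `α_x α_y = Ad(σ_{x,y}) ∘ α_{xy}` -/
  α_comp : ∀ x y a, α x (α y a) =
    (σ x y : 𝓜(ℂ, A)).fst (((σ x y)⁻¹ : (𝓜(ℂ, A))ˣ).val.snd (α (x * y) a))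
  /-- `α_z(σ_{x,y}) σ_{z,xy} = σ_{z,x} σ_{zx,y}` -/
  cocycle : ∀ x y z, liftAut (α z) (α_mul z) (σ x y) * (σ z (x * y) : 𝓜(ℂ, A)) =
    (σ z x : 𝓜(ℂ, A)) * (σ (z * x) y : 𝓜(ℂ, A))

variable {G : Type uG} [Group G] [TopologicalSpace G]
  {A : Type uA} [NonUnitalNormedRing A] [NormedSpace ℂ A] [SMulCommClass ℂ A A]
  [IsScalarTower ℂ A A]

/-- A covariant representation `(π, u)` of `(G, A, α, σ)` on a complex Banach space `E`. -/
structure CovariantRep [HasCAI A] (S : TwistedAction G A) where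
  /-- the Banach space -/
  E : Type uE
  [normedE : NormedAddCommGroup E]
  [spaceE : NormedSpace ℂ E]
  [completeE : CompleteSpace E]
  /-- the representation of `A` -/
  π : A →L[ℂ] (E →L[ℂ] E)
  π_mul : ∀ a b, π (a * b) = π a * π b
  nondegenerate : Nondegenerate π
  /-- the isometries `u_x` -/
  u : G → (E ≃ₗᵢ[ℂ] E)
  continuous_u : ∀ ξ, Continuous fun x => u x ξ
  /-- `u_x u_y = π̂(σ_{x,y}) u_{xy}` -/
  u_mul : ∀ x y ξ, u x (u y ξ) = hatRep π π_mul nondegenerate (S.σ x y) (u (x * y) ξ)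
  /-- `π(α_x(a)) = u_x π(a) u_x⁻¹` -/
  covariant : ∀ x a ξ, π (S.α x a) ξ = u x (π a ((u x).symm ξ))

attribute [instance] CovariantRep.normedE CovariantRep.spaceE CovariantRep.completeE

variable [MeasurableSpace G]

section Convolution

variable (μ : Measure G)

/-- The integrand `y ↦ f(y) α_y(g(y⁻¹x)) σ_{y,y⁻¹x}` of the twisted convolution at `x`. -/
def convIntegrand (S : TwistedAction G A) (f g : G → A) (x y : G) : A :=
  (S.σ y (y⁻¹ * x) : 𝓜(ℂ, A)).snd (f y * S.α y (g (y⁻¹ * x)))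

/-- The twisted convolution `(f * g)(x) = ∫ f(y) α_y(g(y⁻¹x)) σ_{y,y⁻¹x} dy`. -/
def convFun (S : TwistedAction G A) (f g : G → A) (x : G) : A :=
  ∫ y, convIntegrand S f g x y ∂μ

open Classical in
/-- The twisted convolution of two classes in `L¹(G; A)`. The main theorem includes that
`convFun μ S f g` is always integrable, so that the value `0` is never used. -/
def conv (S : TwistedAction G A) (f g : Lp A 1 μ) : Lp A 1 μ :=
  if h : Integrable (convFun μ S f g) μ then h.toL1 _ else 0

end Convolution

section Integrated

variable [BorelSpace G] [IsTopologicalGroup G] [LocallyCompactSpace G] [HasCAI A]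
  {S : TwistedAction G A} (μ : Measure G) [μ.Regular] (r : CovariantRep.{uG, uA, uE} S)

theorem CovariantRep.norm_apply_le (a : A) (x : G) (ξ : r.E) :
    ‖r.π a (r.u x ξ)‖ ≤ ‖r.π‖ * ‖a‖ * ‖ξ‖ := by
  calc ‖r.π a (r.u x ξ)‖ ≤ ‖r.π a‖ * ‖r.u x ξ‖ := (r.π a).le_opNorm _
    _ ≤ ‖r.π‖ * ‖a‖ * ‖ξ‖ := by
      rw [LinearIsometryEquiv.norm_map]; gcongr; exact r.π.le_opNorm a

theorem CovariantRep.integrable {f : G → A} (hf : Integrable f μ) (ξ : r.E) :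
    Integrable (fun x => r.π (f x) (r.u x ξ)) μ := by
  have hmeas : AEStronglyMeasurable (fun x => r.π (f x) (r.u x ξ)) μ := by
    have hK : ∀ K : Set G, IsCompact K → IsClosed K →
        AEStronglyMeasurable (fun x => r.π (f x) (r.u x ξ)) (μ.restrict K) := by
      intro K hK hKc
      have h1 : AEStronglyMeasurable (fun x => r.u x ξ) (μ.restrict K) :=
        (r.continuous_u ξ).continuousOn.aestronglyMeasurable_of_isCompact hK hKc.measurableSet
      exact r.π.aestronglyMeasurable_comp₂ hf.1.restrict h1
    have hfin : ∀ s : Set G, MeasurableSet s → μ s ≠ ⊤ →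
        AEStronglyMeasurable (fun x => r.π (f x) (r.u x ξ)) (μ.restrict s) := by
      intro s hs hμs
      choose K hKs hKc hKcl hKm using fun n : ℕ =>
        hs.exists_isCompact_isClosed_sdiff_lt (μ := μ) hμs
          (ε := ((n : ENNReal) + 1)⁻¹) (by simp)
      have h0 : μ (s \ ⋃ n, K n) = 0 := by
        refine le_antisymm (ge_of_tendsto' (x := atTop) (f := fun n : ℕ => ((n : ENNReal) + 1)⁻¹)
          ?_ fun n => ?_) zero_le
        · simpa using (tendsto_add_atTop_iff_nat (f := fun n : ℕ => (n : ENNReal)⁻¹) 1).2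
            ENNReal.tendsto_inv_nat_nhds_zero
        · exact (measure_mono (Set.sdiff_subset_sdiff_right (Set.subset_iUnion K n))).trans
            (hKm n).le
      have hs' : s = (s \ ⋃ n, K n) ∪ ⋃ n, K n := by
        rw [Set.sdiff_union_of_subset (Set.iUnion_subset hKs)]
      rw [hs', aestronglyMeasurable_union_iff, aestronglyMeasurable_iUnion_iff]
      refine ⟨?_, fun n => hK _ (hKc n) (hKcl n)⟩
      rw [Measure.restrict_eq_zero.2 h0]
      exact aestronglyMeasurable_zero_measure _
    let s : ℕ → Set G := fun n => toMeasurable μ {x | 1 / ((n : ℝ) + 1) ≤ ‖f x‖}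
    have hs : ∀ n, μ (s n) ≠ ⊤ := fun n => by
      rw [measure_toMeasurable]
      exact (hf.measure_norm_ge_lt_top (by positivity)).ne
    have hms : MeasurableSet (⋃ n, s n) :=
      MeasurableSet.iUnion fun n => measurableSet_toMeasurable _ _
    have hzero : ∀ x ∈ (⋃ n, s n)ᶜ, f x = 0 := by
      intro x hx
      by_contra hne
      obtain ⟨n, hn⟩ := exists_nat_one_div_lt (norm_pos_iff.2 hne)
      exact hx (Set.mem_iUnion.2 ⟨n, subset_toMeasurable _ _ hn.le⟩)
    rw [← Measure.restrict_univ (μ := μ), ← Set.union_compl_self (⋃ n, s n),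
      aestronglyMeasurable_union_iff, aestronglyMeasurable_iUnion_iff]
    refine ⟨fun n => hfin _ (measurableSet_toMeasurable _ _) (hs n), ?_⟩
    refine (aestronglyMeasurable_const (b := (0 : r.E))).congr ?_
    filter_upwards [ae_restrict_mem hms.compl] with x hx
    simp [hzero x hx]
  refine ((hf.norm.const_mul ‖r.π‖).mul_const ‖ξ‖).mono' hmeas (Eventually.of_forall fun x => ?_)
  exact r.norm_apply_le (f x) x ξ

/-- The integrated representation `π ⋊ u : L¹(G, A, α, σ) → B(E)`,
`(π ⋊ u)(f) = ∫ π(f(x)) u_x dx`, the integral being taken in the strong sense. -/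
def CovariantRep.integrated : Lp A 1 μ →L[ℂ] (r.E →L[ℂ] r.E) :=
  LinearMap.mkContinuous₂
    (LinearMap.mk₂ ℂ (fun (f : Lp A 1 μ) (ξ : r.E) => ∫ x, r.π (f x) (r.u x ξ) ∂μ)
      (fun f g ξ => by
        rw [← integral_add (r.integrable μ (L1.integrable_coeFn f) ξ)
          (r.integrable μ (L1.integrable_coeFn g) ξ)]
        refine integral_congr_ae ?_
        filter_upwards [Lp.coeFn_add f g] with x hx
        rw [hx]
        simp)
      (fun c f ξ => by
        rw [← integral_smul]
        refine integral_congr_ae ?_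
        filter_upwards [Lp.coeFn_smul c f] with x hx
        simp [hx])
      (fun f ξ η => by
        rw [← integral_add (r.integrable μ (L1.integrable_coeFn f) ξ)
          (r.integrable μ (L1.integrable_coeFn f) η)]
        simp)
      (fun c f ξ => by
        rw [← integral_smul]
        simp))
    ‖r.π‖
    (fun f ξ => by
      refine (norm_integral_le_of_norm_le
        (((L1.integrable_coeFn f).norm.const_mul ‖r.π‖).mul_const ‖ξ‖)
        (Eventually.of_forall fun x => r.norm_apply_le (f x) x ξ)).trans (le_of_eq ?_)
      rw [integral_mul_const, integral_const_mul, ← L1.norm_eq_integral_norm])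

theorem CovariantRep.integrated_apply (f : Lp A 1 μ) (ξ : r.E) :
    r.integrated μ f ξ = ∫ x, r.π (f x) (r.u x ξ) ∂μ := rfl

theorem CovariantRep.norm_integrated_le (f : Lp A 1 μ) :
    ‖r.integrated μ f‖ ≤ ‖r.π‖ * ‖f‖ :=
  ((r.integrated μ).le_opNorm f).trans
    (mul_le_mul_of_nonneg_right
      (LinearMap.mkContinuous₂_norm_le (C := ‖r.π‖) _ (norm_nonneg r.π) _) (norm_nonneg f))

end Integrated

section CrossedProduct

variable [HasCAI A] {S : TwistedAction G A}

/-- The class `R` is uniformly bounded: `sup {‖π‖ : (π, u) ∈ R} < ∞`. -/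
def UniformlyBounded (R : Set (CovariantRep.{uG, uA, uE} S)) : Prop :=
  BddAbove {t : ℝ | ∃ r ∈ R, t = ‖r.π‖}

/-- `C_R = sup {‖π‖ : (π, u) ∈ R}`. -/
def bound (R : Set (CovariantRep.{uG, uA, uE} S)) : ℝ :=
  sSup {t : ℝ | ∃ r ∈ R, t = ‖r.π‖}

variable [BorelSpace G] [IsTopologicalGroup G] [LocallyCompactSpace G]
  (μ : Measure G) [μ.Regular] (R : Set (CovariantRep.{uG, uA, uE} S))

/-- `‖f‖_R = sup {‖(π ⋊ u)(f)‖ : (π, u) ∈ R}`. -/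
def crossedNorm (f : Lp A 1 μ) : ℝ :=
  sSup {t : ℝ | ∃ r ∈ R, t = ‖r.integrated μ f‖}

variable {R}

theorem crossedNorm_bdd (hR : UniformlyBounded R) (f : Lp A 1 μ) :
    BddAbove {t : ℝ | ∃ r ∈ R, t = ‖r.integrated μ f‖} := by
  obtain ⟨C, hC⟩ := hR
  refine ⟨C * ‖f‖, ?_⟩
  rintro _ ⟨r, hr, rfl⟩
  exact (r.norm_integrated_le μ f).trans (by gcongr; exact hC ⟨r, hr, rfl⟩)

theorem crossedNorm_nonneg (f : Lp A 1 μ) : 0 ≤ crossedNorm μ R f := by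
  refine Real.sSup_nonneg ?_
  rintro _ ⟨r, hr, rfl⟩
  positivity

theorem le_crossedNorm (hR : UniformlyBounded R) {r : CovariantRep.{uG, uA, uE} S} (hr : r ∈ R)
    (f : Lp A 1 μ) : ‖r.integrated μ f‖ ≤ crossedNorm μ R f :=
  le_csSup (crossedNorm_bdd μ hR f) ⟨r, hr, rfl⟩

/-- `‖·‖_R` as a seminorm on `L¹(G; A)`. -/
def crossedSeminorm (hR : UniformlyBounded R) : Seminorm ℂ (Lp A 1 μ) :=
  Seminorm.ofSMulLE (crossedNorm μ R)
    (le_antisymm (Real.sSup_le (by rintro _ ⟨r, hr, rfl⟩; simp) le_rfl) (crossedNorm_nonneg μ 0))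
    (fun f g => by
      refine Real.sSup_le ?_ (add_nonneg (crossedNorm_nonneg μ f) (crossedNorm_nonneg μ g))
      rintro _ ⟨r, hr, rfl⟩
      rw [map_add]
      exact (norm_add_le _ _).trans (add_le_add (le_crossedNorm μ hR hr f)
        (le_crossedNorm μ hR hr g)))
    (fun c f => by
      refine Real.sSup_le ?_ (mul_nonneg (norm_nonneg _) (crossedNorm_nonneg μ f))
      rintro _ ⟨r, hr, rfl⟩
      rw [map_smul, norm_smul]
      gcongr
      exact le_crossedNorm μ hR hr f)

/-- `L¹(G; A)` equipped with the seminorm `‖·‖_R` in place of the `L¹`-norm. -/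
@[nolint unusedArguments]
def PreCrossedProduct (_ : UniformlyBounded R) : Type (max uG uA) := Lp A 1 μ

instance (hR : UniformlyBounded R) : SeminormedAddCommGroup (PreCrossedProduct μ hR) :=
  (crossedSeminorm μ hR).toAddGroupSeminorm.toSeminormedAddCommGroup

instance (hR : UniformlyBounded R) : NormedSpace ℂ (PreCrossedProduct μ hR) :=
  { (inferInstanceAs (Module ℂ (Lp A 1 μ)) : Module ℂ (Lp A 1 μ)) with
    norm_smul_le := fun c f => (map_smul_eq_mul (crossedSeminorm μ hR) c f).le }

/-- The twisted crossed product `F_R(G, A, α, σ)`: the Hausdorff completion of `L¹(G, A, α, σ)`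
with respect to `‖·‖_R`, that is, the completion of `L¹ / ker ‖·‖_R`. -/
def CrossedProduct (hR : UniformlyBounded R) : Type (max uG uA) :=
  UniformSpace.Completion (PreCrossedProduct μ hR)

instance (hR : UniformlyBounded R) : NormedAddCommGroup (CrossedProduct μ hR) :=
  inferInstanceAs (NormedAddCommGroup (UniformSpace.Completion (PreCrossedProduct μ hR)))

instance (hR : UniformlyBounded R) : NormedSpace ℂ (CrossedProduct μ hR) :=
  inferInstanceAs (NormedSpace ℂ (UniformSpace.Completion (PreCrossedProduct μ hR)))

instance (hR : UniformlyBounded R) : CompleteSpace (CrossedProduct μ hR) :=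
  inferInstanceAs (CompleteSpace (UniformSpace.Completion (PreCrossedProduct μ hR)))

/-- The canonical linear map `τ_R : L¹(G, A, α, σ) → F_R(G, A, α, σ)`, with dense range. -/
def toCrossedProduct (hR : UniformlyBounded R) : Lp A 1 μ →ₗ[ℂ] CrossedProduct μ hR where
  toFun f := ((show PreCrossedProduct μ hR from f : PreCrossedProduct μ hR) :
    UniformSpace.Completion (PreCrossedProduct μ hR))
  map_add' _ _ := UniformSpace.Completion.coe_add _ _
  map_smul' c f := UniformSpace.Completion.coe_smul (X := PreCrossedProduct μ hR) c f

theorem norm_toCrossedProduct (hR : UniformlyBounded R) (f : Lp A 1 μ) :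
    ‖toCrossedProduct μ hR f‖ = crossedNorm μ R f :=
  UniformSpace.Completion.norm_coe (E := PreCrossedProduct μ hR) _

theorem denseRange_toCrossedProduct (hR : UniformlyBounded R) :
    DenseRange (toCrossedProduct μ hR) :=
  UniformSpace.Completion.denseRange_coe (α := PreCrossedProduct μ hR)

/-- The multiplication of `F_R(G, A, α, σ)`: the extension by continuity of the twisted
convolution from (the image of) `L¹(G, A, α, σ)` to the completion. -/
instance (hR : UniformlyBounded R) : Mul (CrossedProduct μ hR) where
  mul a b :=
    ((UniformSpace.Completion.isDenseInducing_coe (α := PreCrossedProduct μ hR)).prodMap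
      (UniformSpace.Completion.isDenseInducing_coe (α := PreCrossedProduct μ hR))).extend
      (fun p => toCrossedProduct μ hR (conv μ S p.1 p.2)) (a, b)

end CrossedProduct

end TwistedCP

end

open MeasureTheory TwistedCP

/-! Everything rests on two facts: an integrated form `π ⋊ u` turns twisted convolution into
composition of operators, and `L¹(G; A)` has approximate units of `L¹`-norm at most one.

Multiplicativity (`CovariantRep.integrated_conv`) is a computation for continuous compactly
supported functions: interchange the integrals, substitute `x ↦ yx`, and let `u_y u_x = π̂(σ_{y,x})
u_{yx}` absorb the twist. Since `G` need not be σ-compact, general integrable functions are not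
treated by Tonelli's theorem. They are expanded instead into series of continuous compactly
supported functions with summable `L¹`-norms, and `‖f * g‖₁ ≤ ‖f‖₁ ‖g‖₁` makes the double series of
convolutions converge (`exists_hasSum_convFun`). The expansion of `g` holds only off a null set, so
the map `y ↦ y⁻¹x` must pull null sets back to sets that are null on compact sets; this is
`measure_inter_preimage_inv_mul_eq_zero`.

The seminorm `‖·‖_R` is thus a supremum of operator norms composed with multiplicative maps. It is
submultiplicative, and identities such as associativity need only be checked in each `B(E)`; they
pass to the completion by density and continuity.

The approximate units are `e = φ ⊗ a`, with `φ` a symmetric probability density supported near `1`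
and `a` a contractive approximate unit of `A` for a suitable compact set
(`exists_approx_unit_convFun`). As `‖f‖_R ≤ C_R ‖f‖₁` and `‖e‖₁ ≤ 1`, their images have norm at most
`C_R`, and this bound allows the passage from a dense set of elements to all of them. -/

namespace TwistedCP

/-! ### Null sets of a Haar measure under inversion. -/

section HaarInverse

variable {G : Type*} [Group G] [TopologicalSpace G] [IsTopologicalGroup G]
  [LocallyCompactSpace G] [T2Space G] [MeasurableSpace G] [BorelSpace G]
  (μ : Measure G) [μ.IsHaarMeasure] [μ.Regular]

/-- On compactly supported functions, the inverse of a Haar measure has a continuous positive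
density with respect to it. -/
theorem exists_density_inv : ∃ D : G → ℝ, Continuous D ∧ (∀ x, 0 ≤ D x) ∧
    ∀ φ : G → ℝ, Continuous φ → HasCompactSupport φ →
      ∫ x, φ x ∂μ.inv = ∫ x, φ x * D x ∂μ := by
  obtain ⟨⟨g, hg⟩, h'g, g0, g1⟩ :
    ∃ g : C(G, ℝ), HasCompactSupport g ∧ 0 ≤ g ∧ g 1 ≠ 0 := exists_continuous_nonneg_pos 1
  have g0 : ∀ x, 0 ≤ g x := g0
  have hD : Continuous fun y => ∫ z, g (z⁻¹ * y) ∂μ.inv :=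
    continuous_integral_apply_inv_mul hg h'g
  have hDpos : ∀ y, 0 < ∫ z, g (z⁻¹ * y) ∂μ.inv := fun y => by
    have C : Continuous fun z => g (z⁻¹ * y) := by fun_prop
    refine C.integral_pos_of_hasCompactSupport_nonneg_nonzero (x := y) ?_ (fun _ => g0 _)
      (by simpa using g1)
    exact h'g.comp_homeomorph ((Homeomorph.inv G).trans (Homeomorph.mulRight y))
  have hc : 0 < ∫ x, g x ∂μ :=
    hg.integral_pos_of_hasCompactSupport_nonneg_nonzero h'g g0 g1
  refine ⟨fun y => (∫ z, g (z⁻¹ * y) ∂μ.inv) * (∫ x, g x ∂μ)⁻¹, by fun_prop,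
    fun y => mul_nonneg (hDpos y).le (inv_nonneg.2 hc.le), fun φ hφ h'φ => ?_⟩
  -- This identity compares a left with a right invariant measure by dividing the integrand by `∫
  -- g(z⁻¹y)`. Putting that factor into the test function beforehand cancels it.
  have key := Measure.integral_isMulLeftInvariant_isMulRightInvariant_combo (μ := μ) (ν := μ.inv)
    (f := fun y => φ y * ((∫ z, g (z⁻¹ * y) ∂μ.inv) * (∫ x, g x ∂μ)⁻¹)) (by fun_prop)
    h'φ.mul_right hg h'g g0 g1
  rw [key, ← integral_mul_const]
  congr 1 with y
  have := (hDpos y).ne'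
  field_simp

/-- The density is bounded on a compact neighbourhood `V` of `K`. An open set of small `μ`-measure
around `P`, intersected with the interior of `V`, therefore has small `μ.inv`-measure; Urysohn
functions carry the integral formula over to measures. -/
theorem inv_measure_null_of_subset_isCompact {P K : Set G} (hP : μ P = 0) (hK : IsCompact K)
    (hPK : P ⊆ K) : μ.inv P = 0 := by
  obtain ⟨D, hD, hD0, hint⟩ := exists_density_inv μ
  obtain ⟨V, hV, hKV⟩ := exists_compact_superset hK
  obtain ⟨M, hM⟩ := (hV.image hD).bddAbove
  have hM' : ∀ x ∈ V, D x ≤ max M 1 := fun x hx =>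
    (hM (Set.mem_image_of_mem D hx)).trans (le_max_left _ _)
  have hM0 : 0 < max M 1 := lt_max_of_lt_right one_pos
  refine le_antisymm (ENNReal.le_of_forall_pos_le_add fun ε hε _ => ?_) zero_le
  rw [zero_add]
  obtain ⟨U, hPU, hU, hμU⟩ := P.exists_isOpen_lt_of_lt (μ := μ) (ENNReal.ofReal (ε / max M 1))
    (by rw [hP]; exact ENNReal.ofReal_pos.2 (by positivity))
  have hW : IsOpen (U ∩ interior V) := hU.inter isOpen_interior
  refine (measure_mono (Set.subset_inter hPU (hPK.trans hKV))).trans ?_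
  rw [hW.measure_eq_iSup_isCompact]
  refine iSup₂_le fun L hLW => iSup_le fun hL => ?_
  obtain ⟨φ, hφ1, hφ0, hφc, hφ⟩ := exists_continuous_one_zero_of_isCompact hL
    hW.isClosed_compl (Set.disjoint_compl_right_iff_subset.2 hLW)
  have hμW : μ (U ∩ interior V) ≠ ⊤ :=
    ((measure_mono Set.inter_subset_left).trans_lt (hμU.trans ENNReal.ofReal_lt_top)).ne
  have h1 : μ.inv L ≤ ENNReal.ofReal (∫ x, φ x ∂μ.inv) := by
    rw [hL.measure_eq_biInf_integral_hasCompactSupport]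
    exact iInf_le_of_le φ (iInf_le_of_le φ.continuous (iInf_le_of_le hφc
      (iInf_le_of_le hφ1 (iInf_le _ fun x => (hφ x).1))))
  refine h1.trans ?_
  rw [hint φ φ.continuous hφc, ← ENNReal.ofReal_coe_nnreal]
  refine ENNReal.ofReal_le_ofReal ?_
  have h2 : ∀ x, φ x * D x ≤ (U ∩ interior V).indicator (fun _ => max M 1) x := fun x => by
    by_cases hx : x ∈ U ∩ interior V
    · rw [Set.indicator_of_mem hx]
      calc φ x * D x ≤ 1 * max M 1 :=
            mul_le_mul (hφ x).2 (hM' x (interior_subset hx.2)) (hD0 x) zero_le_one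
        _ = _ := one_mul _
    · rw [Set.indicator_of_notMem hx, hφ0 hx]
      simp
  calc ∫ x, φ x * D x ∂μ
      ≤ ∫ x, (U ∩ interior V).indicator (fun _ => max M 1) x ∂μ :=
        integral_mono ((φ.continuous.mul hD).integrable_of_hasCompactSupport hφc.mul_right)
          ((integrable_indicator_iff hW.measurableSet).2 (integrableOn_const hμW)) h2
    _ = μ.real (U ∩ interior V) * max M 1 := by
        rw [integral_indicator hW.measurableSet, setIntegral_const, smul_eq_mul]
    _ ≤ (ε / max M 1) * max M 1 := by
        gcongr
        exact ENNReal.toReal_le_of_le_ofReal (by positivity)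
          ((measure_mono Set.inter_subset_left).trans hμU.le)
    _ = ε := by field_simp

/-- The translates of the inverse of a null set are null on compact sets. -/
theorem measure_inter_preimage_inv_mul_eq_zero {N K : Set G} (hN : μ N = 0) (hK : IsCompact K)
    (x : G) : μ {y | y ∈ K ∧ y⁻¹ * x ∈ N} = 0 := by
  have hL : IsCompact ((fun y => y⁻¹ * x) '' K) := hK.image (by fun_prop)
  have h := inv_measure_null_of_subset_isCompact μ
    (measure_mono_null (Set.inter_subset_left (t := (fun y => y⁻¹ * x) '' K)) hN) hL
    Set.inter_subset_right
  -- By left invariance, `{y | y⁻¹x ∈ N}` is as large as `N⁻¹`, of which it is a left translate.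
  rw [Measure.inv_apply, ← measure_preimage_mul μ x⁻¹] at h
  refine measure_mono_null (fun y hy => ?_) h
  exact ⟨by simpa using hy.2, y, hy.1, by simp⟩

end HaarInverse

/-! ### Series with summable `L¹`-norms. -/

section Series

variable {X E : Type*} [MeasurableSpace X] {μ : Measure X} [NormedAddCommGroup E]
  {ι : Type*} [Countable ι] {F : ι → X → E}

theorem tsum_enorm_toL1_ne_top (hF : ∀ i, Integrable (F i) μ)
    (hs : Summable fun i => ∫ x, ‖F i x‖ ∂μ) : ∑' i, ‖(hF i).toL1 (F i)‖ₑ ≠ ⊤ := by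
  rw [tsum_enorm_ne_top_iff_summable_norm]
  simpa [L1.norm_of_fun_eq_integral_norm] using hs

theorem ae_summable_norm_of_summable_integral_norm (hF : ∀ i, Integrable (F i) μ)
    (hs : Summable fun i => ∫ x, ‖F i x‖ ∂μ) : ∀ᵐ x ∂μ, Summable fun i => ‖F i x‖ := by
  refine summable_norm_of_tsum_eLpNorm_ne_top le_rfl (fun i => (hF i).1) ?_
  convert tsum_enorm_toL1_ne_top hF hs using 3 with i
  rw [Integrable.enorm_toL1, eLpNorm_one_eq_lintegral_enorm]

/-- A pointwise almost everywhere convergent series of functions with summable `L¹`-norms converges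
in `L¹`. -/
theorem exists_hasSum_toL1 [CompleteSpace E] (hF : ∀ i, Integrable (F i) μ)
    (hs : Summable fun i => ∫ x, ‖F i x‖ ∂μ) {f : X → E}
    (hf : ∀ᵐ x ∂μ, HasSum (fun i => F i x) (f x)) :
    ∃ h : Integrable f μ, HasSum (fun i => (hF i).toL1 (F i)) (h.toL1 f) := by
  have htop := tsum_enorm_toL1_ne_top hF hs
  have hfg : f =ᵐ[μ] (∑' i, (hF i).toL1 (F i) : Lp E 1 μ) := by
    filter_upwards [hf, Lp.hasSum_coeFn_tsum htop, ae_all_iff.2 fun i => (hF i).coeFn_toL1]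
      with x h1 h2 h3
    simp only [h3] at h2
    exact h1.unique h2
  refine ⟨(L1.integrable_coeFn _).congr hfg.symm, ?_⟩
  have : ((L1.integrable_coeFn _).congr hfg.symm).toL1 f = ∑' i, (hF i).toL1 (F i) :=
    (Integrable.toL1_eq_toL1_iff _ _ _ (L1.integrable_coeFn _)).2 hfg |>.trans
      (Integrable.toL1_coeFn _ _)
  rw [this]
  exact (tsum_enorm_ne_top_iff_summable_norm.1 htop).of_norm.hasSum

end Series

/-! ### Approximation in `L¹` by continuous functions of compact support. -/

section Approximation

variable {G : Type*} [TopologicalSpace G] [RegularSpace G] [LocallyCompactSpace G]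
  [MeasurableSpace G] [BorelSpace G] {μ : Measure G} [μ.Regular]
  {A : Type*} [NormedAddCommGroup A] [NormedSpace ℝ A] [CompleteSpace A]

/-- Compactly supported continuous functions are dense in `L¹` of a locally compact space, which
need not be normal. -/
theorem exists_hasCompactSupport_eLpNorm_sub_le {f : G → A} (hf : MemLp f 1 μ) {ε : ENNReal}
    (hε : ε ≠ 0) : ∃ g : G → A, eLpNorm (f - g) 1 μ ≤ ε ∧ Continuous g ∧ HasCompactSupport g := by
  refine hf.induction_dense ENNReal.one_ne_top _ ?_ ?_ ?_ hε
  · intro c t ht htμ ε hε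
    obtain ⟨η, hη0, hη⟩ := exists_eLpNorm_indicator_le (μ := μ) ENNReal.one_ne_top c hε
    have hη2 : (η / 2 : ENNReal) ≠ 0 := by simpa using hη0.ne'
    obtain ⟨s, hst, hs, hsc, hμs⟩ := ht.exists_isCompact_isClosed_sdiff_lt htμ.ne hη2
    obtain ⟨V, hsV, hV, -, hμV⟩ :=
      hsc.measurableSet.exists_isOpen_sdiff_lt (hs.measure_lt_top (μ := μ)).ne hη2
    obtain ⟨φ, hφ1, hφ0, hφc, hφ⟩ := exists_continuous_one_zero_of_isCompact hs
      hV.isClosed_compl (Set.disjoint_compl_right_iff_subset.2 hsV)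
    refine ⟨fun x => φ x • c, ?_, by fun_prop, hφc.smul_right⟩
    -- `φ • c` and the indicator of `t` with value `c` agree off `(V \ s) ∪ (t \ s)`, and on it they
    -- differ by at most `‖c‖`.
    refine (eLpNorm_mono fun x => ?_).trans (hη ((V \ s) ∪ (t \ s)) ?_)
    · by_cases hx : x ∈ (V \ s) ∪ (t \ s)
      · have hxs : x ∉ s := hx.elim (fun h => h.2) fun h => h.2
        have h01 := hφ x
        rw [Set.indicator_of_mem hx]
        by_cases hxt : x ∈ t
        · simp only [Pi.sub_apply, Set.indicator_of_mem hxt]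
          calc ‖φ x • c - c‖ = |φ x - 1| * ‖c‖ := by
                rw [← Real.norm_eq_abs, ← norm_smul, sub_smul, one_smul]
            _ ≤ 1 * ‖c‖ := by
                gcongr
                rw [abs_le]
                constructor <;> linarith [h01.1, h01.2]
            _ = ‖c‖ := one_mul _
        · simp only [Pi.sub_apply, Set.indicator_of_notMem hxt, sub_zero, norm_smul,
            Real.norm_of_nonneg h01.1]
          exact mul_le_of_le_one_left (norm_nonneg _) h01.2
      · rw [Set.indicator_of_notMem hx]
        by_cases hxs : x ∈ s
        · simp [Set.indicator_of_mem (hst hxs), hφ1 hxs]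
        · have hxV : x ∉ V := fun h => hx (Or.inl ⟨h, hxs⟩)
          have hxt : x ∉ t := fun h => hx (Or.inr ⟨h, hxs⟩)
          simp [Set.indicator_of_notMem hxt, hφ0 hxV]
    · calc μ ((V \ s) ∪ (t \ s)) ≤ η / 2 + η / 2 :=
            (measure_union_le _ _).trans (add_le_add hμV.le hμs.le)
        _ = η := ENNReal.add_halves _
  · rintro f g ⟨hf, cf⟩ ⟨hg, cg⟩
    exact ⟨hf.add hg, cf.add cg⟩
  · rintro f ⟨hf, cf⟩
    exact (hf.integrable_of_hasCompactSupport (μ := μ) cf).1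

theorem exists_hasCompactSupport_norm_sub_lt (f : Lp A 1 μ) {ε : ℝ} (hε : 0 < ε) :
    ∃ (g : G → A) (_ : Continuous g) (_ : HasCompactSupport g) (hg : Integrable g μ),
      ‖f - hg.toL1 g‖ < ε := by
  obtain ⟨g, hle, hg, cg⟩ := exists_hasCompactSupport_eLpNorm_sub_le (Lp.memLp f)
    (ε := ENNReal.ofReal (ε / 2)) (by simpa using hε)
  have ig : Integrable g μ := hg.integrable_of_hasCompactSupport cg
  refine ⟨g, hg, cg, ig, ?_⟩
  rw [Lp.norm_def]
  refine (ENNReal.toReal_le_of_le_ofReal (half_pos hε).le ?_).trans_lt (half_lt_self hε)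
  convert hle using 1
  refine eLpNorm_congr_ae ?_
  filter_upwards [Lp.coeFn_sub f (ig.toL1 g), ig.coeFn_toL1] with x h1 h2
  rw [h1, Pi.sub_apply, h2, Pi.sub_apply]

/-- Every integrable function is the sum almost everywhere of a series of compactly supported
continuous functions with summable `L¹`-norms. -/
theorem exists_series_hasCompactSupport {f : G → A} (hf : Integrable f μ) :
    ∃ F : ℕ → G → A, (∀ n, Continuous (F n)) ∧ (∀ n, HasCompactSupport (F n)) ∧
      (Summable fun n => ∫ x, ‖F n x‖ ∂μ) ∧ ∀ᵐ x ∂μ, HasSum (fun n => F n x) (f x) := by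
  let s : AddSubgroup (Lp A 1 μ) :=
    { carrier := {h | ∃ (g : G → A) (_ : Continuous g) (_ : HasCompactSupport g)
        (hg : Integrable g μ), h = hg.toL1 g}
      zero_mem' := ⟨0, continuous_zero, HasCompactSupport.zero, integrable_zero _ _ _, rfl⟩
      add_mem' := by
        rintro _ _ ⟨g, hg, cg, ig, rfl⟩ ⟨h, hh, ch, ih, rfl⟩
        exact ⟨g + h, hg.add hh, cg.add ch, ig.add ih, rfl⟩
      neg_mem' := by
        rintro _ ⟨g, hg, cg, ig, rfl⟩
        exact ⟨-g, hg.neg, cg.neg, ig.neg, rfl⟩ }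
  have hcl : hf.toL1 f ∈ closure (s : Set (Lp A 1 μ)) := by
    refine Metric.mem_closure_iff.2 fun ε hε => ?_
    obtain ⟨g, hg, cg, ig, hlt⟩ := exists_hasCompactSupport_norm_sub_lt (hf.toL1 f) hε
    exact ⟨ig.toL1 g, ⟨g, hg, cg, ig, rfl⟩, by rwa [dist_eq_norm]⟩
  obtain ⟨v, hlim, hv, -, hb⟩ := controlled_sum_of_mem_closure hcl
    (b := fun n => (1 / 2 : ℝ) ^ n) fun n => by positivity
  choose F hF cF iF hvF using hv
  -- The geometric bound holds only from index one on, since the zeroth term approximates `f`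
  -- itself; hence the shift.
  have hs : Summable fun n => ‖v n‖ :=
    (summable_nat_add_iff 1).1 <| Summable.of_nonneg_of_le (fun n => norm_nonneg _)
      (fun n => (hb (n + 1) n.succ_pos).le) ((summable_nat_add_iff 1).2 summable_geometric_two)
  have htop : ∑' n, ‖v n‖ₑ ≠ ⊤ := tsum_enorm_ne_top_iff_summable_norm.2 hs
  have hsum : ∑' n, v n = hf.toL1 f :=
    tendsto_nhds_unique hs.of_norm.hasSum.tendsto_sum_nat ((tendsto_add_atTop_iff_nat 1).1 hlim)
  refine ⟨F, hF, cF, ?_, ?_⟩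
  · simpa [hvF, L1.norm_of_fun_eq_integral_norm] using hs
  · filter_upwards [Lp.hasSum_coeFn_tsum htop, ae_all_iff.2 fun n => (iF n).coeFn_toL1,
      hf.coeFn_toL1] with x h1 h2 h3
    rw [hsum, h3] at h1
    simpa only [hvF, h2] using h1

end Approximation

/-! ### Twisted convolution of continuous functions of compact support. -/

section

section Algebraic

variable {A : Type*} [NonUnitalNormedRing A] [NormedSpace ℂ A] [SMulCommClass ℂ A A]
  [IsScalarTower ℂ A A]

theorem norm_snd_apply_le (m : 𝓜(ℂ, A)) (a : A) : ‖m.snd a‖ ≤ ‖m‖ * ‖a‖ := by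
  refine (m.snd.le_opNorm a).trans (mul_le_mul_of_nonneg_right ?_ (norm_nonneg _))
  rw [DoubleCentralizer.norm_def]
  exact norm_snd_le (DoubleCentralizer.toProdHom m)

/-- By nondegeneracy it suffices to test on vectors `π(b)η`, where the claim is the centrality
relation `(a m) b = a (m b)`. -/
theorem map_snd_eq_hatRep [HasCAI A] {E : Type*} [NormedAddCommGroup E] [NormedSpace ℂ E]
    [CompleteSpace E] (π : A →L[ℂ] (E →L[ℂ] E)) (hπ : ∀ a b, π (a * b) = π a * π b)
    (hn : Nondegenerate π) (m : 𝓜(ℂ, A)) (a : A) (ξ : E) :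
    π (m.snd a) ξ = π a (hatRep π hπ hn m ξ) := by
  have : π (m.snd a) = (π a).comp (hatRep π hπ hn m) := hn.ext fun b η => by
    have h := congrArg (fun c => π c η) (m.central a b)
    simp only [hπ] at h
    rw [ContinuousLinearMap.comp_apply, hatRep_apply]
    exact h
  rw [this, ContinuousLinearMap.comp_apply]

end Algebraic

variable {G : Type*} [Group G] [TopologicalSpace G]
  {A : Type*} [NonUnitalNormedRing A] [NormedSpace ℂ A] [SMulCommClass ℂ A A]
  [IsScalarTower ℂ A A]

namespace TwistedAction

variable (S : TwistedAction G A)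

theorem norm_σ_snd_le (x y : G) (a : A) : ‖(S.σ x y : 𝓜(ℂ, A)).snd a‖ ≤ ‖a‖ := by
  simpa [S.norm_σ] using norm_snd_apply_le (S.σ x y : 𝓜(ℂ, A)) a

/-- Strong continuity becomes joint continuity because the `α_x` are isometric, so that the error
from varying `a` is uniform in `x`. -/
theorem continuous_α_uncurry : Continuous fun p : G × A => S.α p.1 p.2 := by
  refine continuous_iff_continuousAt.2 fun ⟨x, a⟩ => ?_
  refine tendsto_iff_norm_sub_tendsto_zero.2 ?_
  have h1 : Tendsto (fun p : G × A => ‖p.2 - a‖ + ‖S.α p.1 a - S.α x a‖) (𝓝 (x, a)) (𝓝 0) := by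
    have : Continuous fun p : G × A => ‖p.2 - a‖ + ‖S.α p.1 a - S.α x a‖ := by
      have := (S.continuous_α a).comp (continuous_fst (X := G) (Y := A))
      have h2 : Continuous fun p : G × A => S.α p.1 a := this
      fun_prop
    simpa using this.tendsto (x, a)
  refine squeeze_zero (fun _ => norm_nonneg _) (fun p => ?_) h1
  calc ‖S.α p.1 p.2 - S.α x a‖ = ‖S.α p.1 (p.2 - a) + (S.α p.1 a - S.α x a)‖ := by
        rw [map_sub]; abel_nf
    _ ≤ _ := (norm_add_le _ _).trans_eq (by rw [LinearIsometryEquiv.norm_map])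

/-- Applying the isometry `α_p` turns `‖α_p⁻¹(b) - α_x⁻¹(a)‖` into `‖b - α_p(α_x⁻¹(a))‖`, which
involves no varying inverse. -/
theorem continuous_α_symm_uncurry : Continuous fun p : G × A => (S.α p.1).symm p.2 := by
  refine continuous_iff_continuousAt.2 fun ⟨x, a⟩ => ?_
  refine tendsto_iff_norm_sub_tendsto_zero.2 ?_
  have h1 : Tendsto (fun p : G × A => ‖p.2 - S.α p.1 ((S.α x).symm a)‖) (𝓝 (x, a)) (𝓝 0) := by
    have : Continuous fun p : G × A => ‖p.2 - S.α p.1 ((S.α x).symm a)‖ := by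
      have h2 : Continuous fun p : G × A => S.α p.1 ((S.α x).symm a) :=
        (S.continuous_α _).comp continuous_fst
      fun_prop
    simpa using this.tendsto (x, a)
  refine squeeze_zero (fun _ => norm_nonneg _) (fun p => ?_) h1
  rw [← (S.α p.1).norm_map, map_sub]
  simp

theorem continuous_σ_snd_uncurry :
    Continuous fun p : (G × G) × A => (S.σ p.1.1 p.1.2 : 𝓜(ℂ, A)).snd p.2 := by
  refine continuous_iff_continuousAt.2 fun ⟨x, a⟩ => ?_
  refine tendsto_iff_norm_sub_tendsto_zero.2 ?_
  have h1 : Tendsto (fun p : (G × G) × A => ‖p.2 - a‖ +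
      ‖(S.σ p.1.1 p.1.2 : 𝓜(ℂ, A)).snd a - (S.σ x.1 x.2 : 𝓜(ℂ, A)).snd a‖)
      (𝓝 (x, a)) (𝓝 0) := by
    have : Continuous fun p : (G × G) × A => ‖p.2 - a‖ +
        ‖(S.σ p.1.1 p.1.2 : 𝓜(ℂ, A)).snd a - (S.σ x.1 x.2 : 𝓜(ℂ, A)).snd a‖ := by
      have h2 : Continuous fun p : (G × G) × A => (S.σ p.1.1 p.1.2 : 𝓜(ℂ, A)).snd a :=
        (S.continuous_σ_right a).comp continuous_fst
      fun_prop
    simpa using this.tendsto (x, a)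
  refine squeeze_zero (fun _ => norm_nonneg _) (fun p => ?_) h1
  calc _ = ‖(S.σ p.1.1 p.1.2 : 𝓜(ℂ, A)).snd (p.2 - a) +
        ((S.σ p.1.1 p.1.2 : 𝓜(ℂ, A)).snd a - (S.σ x.1 x.2 : 𝓜(ℂ, A)).snd a)‖ := by
        rw [map_sub]; abel_nf
    _ ≤ _ := (norm_add_le _ _).trans (by gcongr; exact S.norm_σ_snd_le _ _ _)

variable {S} {X : Type*} [TopologicalSpace X]

theorem continuous_α_comp {x : X → G} {a : X → A} (hx : Continuous x) (ha : Continuous a) :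
    Continuous fun t => S.α (x t) (a t) :=
  S.continuous_α_uncurry.comp (hx.prodMk ha)

theorem continuous_α_symm_comp {x : X → G} {a : X → A} (hx : Continuous x) (ha : Continuous a) :
    Continuous fun t => (S.α (x t)).symm (a t) :=
  S.continuous_α_symm_uncurry.comp (hx.prodMk ha)

theorem continuous_σ_snd_comp {x y : X → G} {a : X → A} (hx : Continuous x) (hy : Continuous y)
    (ha : Continuous a) : Continuous fun t => (S.σ (x t) (y t) : 𝓜(ℂ, A)).snd (a t) :=
  S.continuous_σ_snd_uncurry.comp ((hx.prodMk hy).prodMk ha)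

end TwistedAction

section ConvIntegrand

variable (S : TwistedAction G A)

theorem norm_convIntegrand_le (f g : G → A) (x y : G) :
    ‖convIntegrand S f g x y‖ ≤ ‖f y‖ * ‖g (y⁻¹ * x)‖ := by
  refine (S.norm_σ_snd_le _ _ _).trans ((norm_mul_le _ _).trans_eq ?_)
  rw [LinearIsometryEquiv.norm_map]

theorem convIntegrand_of_left_eq_zero {f g : G → A} {x y : G} (h : f y = 0) :
    convIntegrand S f g x y = 0 := by
  simp [convIntegrand, h]

/-- The integrand is a continuous bilinear expression in the two values `f y` and `g (y⁻¹ * x)`, so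
absolute convergence at these two points is all that is needed. -/
theorem hasSum_convIntegrand [CompleteSpace A] {ι κ : Type*} {F : ι → G → A} {H : κ → G → A}
    {f g : G → A} {x y : G} (hF : HasSum (fun i => F i y) (f y))
    (hF' : Summable fun i => ‖F i y‖) (hH : HasSum (fun j => H j (y⁻¹ * x)) (g (y⁻¹ * x)))
    (hH' : Summable fun j => ‖H j (y⁻¹ * x)‖) :
    HasSum (fun p : ι × κ => convIntegrand S (F p.1) (H p.2) x y) (convIntegrand S f g x y) := by
  have hs : Summable fun p : ι × κ => F p.1 y * S.α y (H p.2 (y⁻¹ * x)) := by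
    refine (hF'.mul_of_nonneg hH' (fun _ => norm_nonneg _)
      (fun _ => norm_nonneg _)).of_norm_bounded fun p => ?_
    refine (norm_mul_le _ _).trans_eq ?_
    rw [LinearIsometryEquiv.norm_map]
  exact ((S.σ y (y⁻¹ * x) : 𝓜(ℂ, A)).snd).hasSum
    (hF.mul (((S.α y : A ≃L[ℂ] A) : A →L[ℂ] A).hasSum hH) hs)

variable [IsTopologicalGroup G] {S} {f g : G → A}

theorem continuous_convIntegrand (hf : Continuous f) (hg : Continuous g) :
    Continuous (Function.uncurry (convIntegrand S f g)) := by
  unfold convIntegrand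
  refine TwistedAction.continuous_σ_snd_comp (by fun_prop) (by fun_prop) ?_
  refine Continuous.mul (by fun_prop) ?_
  exact TwistedAction.continuous_α_comp (by fun_prop) (by fun_prop)

/-- A point `(x, y)` with `k x y ≠ 0` is the image of `(y, y⁻¹x)`, a point of the product of the two
supports, under `(s, t) ↦ (st, s)`. -/
theorem hasCompactSupport_uncurry_of_mul {E F : Type*} [NormedAddCommGroup E]
    [NormedAddCommGroup F] [T2Space G] {f : G → E}
    {g : G → E} (hf : HasCompactSupport f) (hg : HasCompactSupport g) {k : G → G → F}
    (hk : ∀ x y, f y = 0 ∨ g (y⁻¹ * x) = 0 → k x y = 0) :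
    HasCompactSupport (Function.uncurry k) := by
  refine HasCompactSupport.intro
    ((IsCompact.prod hf hg).image (f := fun p : G × G => (p.1 * p.2, p.1)) (by fun_prop)) ?_
  rintro ⟨x, y⟩ hxy
  refine hk x y ?_
  by_contra! h
  exact hxy ⟨(y, y⁻¹ * x), ⟨subset_tsupport _ h.1, subset_tsupport _ h.2⟩, by simp⟩

theorem hasCompactSupport_convIntegrand [T2Space G] (hf : HasCompactSupport f)
    (hg : HasCompactSupport g) : HasCompactSupport (Function.uncurry (convIntegrand S f g)) :=
  hasCompactSupport_uncurry_of_mul hf hg fun x y h => by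
    rcases h with h | h <;> simp [convIntegrand, h]

variable [MeasurableSpace G] [BorelSpace G] [LocallyCompactSpace G] [T2Space G]
  (μ : Measure G)

theorem continuous_integral_of_uncurry {E : Type*} [NormedAddCommGroup E] [NormedSpace ℝ E]
    [IsFiniteMeasureOnCompacts μ] {k : G → G → E} (hk : Continuous (Function.uncurry k))
    (hc : HasCompactSupport (Function.uncurry k)) : Continuous fun x => ∫ y, k x y ∂μ := by
  rw [← continuousOn_univ]
  refine continuousOn_integral_of_compact_support (hc.image continuous_snd) hk.continuousOn ?_
  intro x y _ hy
  by_contra h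
  exact hy ⟨(x, y), subset_tsupport _ h, rfl⟩

theorem hasCompactSupport_integral_of_uncurry {E : Type*} [NormedAddCommGroup E]
    [NormedSpace ℝ E] {k : G → G → E} (hc : HasCompactSupport (Function.uncurry k)) :
    HasCompactSupport fun x => ∫ y, k x y ∂μ := by
  refine HasCompactSupport.intro (hc.image continuous_fst) fun x hx => ?_
  have : ∀ y, k x y = 0 := fun y => by
    by_contra h
    exact hx ⟨(x, y), subset_tsupport _ h, rfl⟩
  simp [this]

theorem continuous_convFun [IsFiniteMeasureOnCompacts μ] (hf : Continuous f) (cf : HasCompactSupport f)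
    (hg : Continuous g) (cg : HasCompactSupport g) : Continuous (convFun μ S f g) :=
  continuous_integral_of_uncurry μ (continuous_convIntegrand hf hg)
    (hasCompactSupport_convIntegrand cf cg)

theorem hasCompactSupport_convFun (cf : HasCompactSupport f) (cg : HasCompactSupport g) :
    HasCompactSupport (convFun μ S f g) :=
  hasCompactSupport_integral_of_uncurry μ (hasCompactSupport_convIntegrand cf cg)

theorem integrable_convIntegrand_of_hasCompactSupport [IsFiniteMeasureOnCompacts μ]
    (hf : Continuous f) (cf : HasCompactSupport f) (hg : Continuous g) (x : G) :
    Integrable (convIntegrand S f g x) μ := by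
  have h : Continuous (convIntegrand S f g x) :=
    (continuous_convIntegrand hf hg).comp (Continuous.prodMk_right x)
  exact h.integrable_of_hasCompactSupport <|
    cf.mono fun y hy hfy => hy (convIntegrand_of_left_eq_zero S hfy)

/-- The scalar function `x ↦ ∫ ‖f(y)‖ ‖g(y⁻¹x)‖ dy` dominating the twisted convolution. -/
noncomputable def normConv (f g : G → A) (x : G) : ℝ := ∫ y, ‖f y‖ * ‖g (y⁻¹ * x)‖ ∂μ

theorem normConv_nonneg (f g : G → A) (x : G) : 0 ≤ normConv μ f g x :=
  integral_nonneg fun _ => by positivity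

section

variable [IsFiniteMeasureOnCompacts μ] (hf : Continuous f) (cf : HasCompactSupport f)
  (hg : Continuous g) (cg : HasCompactSupport g)
include hf cf hg

theorem integral_norm_convIntegrand_le (x : G) :
    ∫ y, ‖convIntegrand S f g x y‖ ∂μ ≤ normConv μ f g x := by
  refine integral_mono (integrable_convIntegrand_of_hasCompactSupport μ hf cf hg x).norm ?_
    fun y => norm_convIntegrand_le S f g x y
  have : Continuous fun y => ‖f y‖ * ‖g (y⁻¹ * x)‖ := by fun_prop
  exact this.integrable_of_hasCompactSupport cf.norm.mul_right

theorem norm_convFun_le (x : G) : ‖convFun μ S f g x‖ ≤ normConv μ f g x :=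
  (norm_integral_le_integral_norm _).trans (integral_norm_convIntegrand_le μ hf cf hg x)

include cg

theorem integrable_normConv : Integrable (normConv μ f g) μ := by
  have h : HasCompactSupport (Function.uncurry fun x y => ‖f y‖ * ‖g (y⁻¹ * x)‖) :=
    hasCompactSupport_uncurry_of_mul cf cg fun x y h => by rcases h with h | h <;> simp [h]
  exact (continuous_integral_of_uncurry μ (by fun_prop) h).integrable_of_hasCompactSupport
    (hasCompactSupport_integral_of_uncurry μ h)

theorem integral_normConv [μ.IsMulLeftInvariant] :
    ∫ x, normConv μ f g x ∂μ = (∫ x, ‖f x‖ ∂μ) * ∫ x, ‖g x‖ ∂μ := by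
  have h : HasCompactSupport (Function.uncurry fun x y => ‖f y‖ * ‖g (y⁻¹ * x)‖) :=
    hasCompactSupport_uncurry_of_mul cf cg fun x y h => by rcases h with h | h <;> simp [h]
  unfold normConv
  -- For continuous compactly supported integrands the interchange needs no σ-finiteness.
  rw [integral_integral_swap_of_hasCompactSupport (by fun_prop) h, ← integral_mul_const]
  congr 1 with y
  rw [integral_const_mul, integral_mul_left_eq_self (fun x => ‖g x‖)]

theorem integrable_convFun_of_hasCompactSupport : Integrable (convFun μ S f g) μ :=
  (continuous_convFun μ hf cf hg cg).integrable_of_hasCompactSupport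
    (hasCompactSupport_convFun μ cf cg)

end

end ConvIntegrand

end

/-! ### Multiplicativity of the integrated form, and convolution on all of `L¹`. -/

section

universe uG uA uE

variable {G : Type uG} [Group G] [TopologicalSpace G] [IsTopologicalGroup G]
  [LocallyCompactSpace G] [T2Space G] [MeasurableSpace G] [BorelSpace G]
  (μ : Measure G) [μ.IsHaarMeasure] [μ.Regular]
  {A : Type uA} [NonUnitalNormedRing A] [NormedSpace ℂ A] [SMulCommClass ℂ A A]
  [IsScalarTower ℂ A A] [CompleteSpace A]
  {S : TwistedAction G A}

section Representation

variable [HasCAI A] (r : CovariantRep.{uG, uA, uE} S)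

theorem CovariantRep.integrated_toL1_apply {f : G → A} (hf : Integrable f μ) (ξ : r.E) :
    r.integrated μ (hf.toL1 f) ξ = ∫ x, r.π (f x) (r.u x ξ) ∂μ := by
  rw [r.integrated_apply μ]
  refine integral_congr_ae ?_
  filter_upwards [hf.coeFn_toL1] with x hx
  rw [hx]

/-- This is where the axioms meet: `π̂(σ_{y,x}) u_{yx} = u_y u_x` removes the twist, and then
`π(α_y(b)) u_y = u_y π(b)` moves `u_y` to the left. -/
theorem CovariantRep.map_convIntegrand_mul (f g : G → A) (x y : G) (ξ : r.E) :
    r.π (convIntegrand S f g (y * x) y) (r.u (y * x) ξ) =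
      r.π (f y) (r.u y (r.π (g x) (r.u x ξ))) := by
  unfold convIntegrand
  rw [inv_mul_cancel_left, map_snd_eq_hatRep r.π r.π_mul r.nondegenerate, ← r.u_mul, r.π_mul]
  change r.π (f y) (r.π (S.α y (g x)) _) = _
  rw [r.covariant, LinearIsometryEquiv.symm_apply_apply]

theorem CovariantRep.integrated_convFun_of_hasCompactSupport {f g : G → A}
    (hf : Continuous f) (cf : HasCompactSupport f) (hg : Continuous g) (cg : HasCompactSupport g)
    (hfi : Integrable f μ) (hgi : Integrable g μ) (hfg : Integrable (convFun μ S f g) μ) :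
    r.integrated μ (hfg.toL1 _) = r.integrated μ (hfi.toL1 f) * r.integrated μ (hgi.toL1 g) := by
  ext ξ
  change _ = r.integrated μ (hfi.toL1 f) (r.integrated μ (hgi.toL1 g) ξ)
  simp only [r.integrated_toL1_apply μ]
  have hk : Continuous
      (Function.uncurry fun x y => r.π (convIntegrand S f g x y) (r.u x ξ)) := by
    have h1 := continuous_convIntegrand (S := S) hf hg
    have h2 : Continuous fun p : G × G => r.u p.1 ξ := (r.continuous_u ξ).comp continuous_fst
    exact (r.π.continuous.comp h1).clm_apply h2
  have hc : HasCompactSupport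
      (Function.uncurry fun x y => r.π (convIntegrand S f g x y) (r.u x ξ)) :=
    hasCompactSupport_uncurry_of_mul cf cg fun x y h => by
      rcases h with h | h <;> simp [convIntegrand, h]
  have hint : Integrable (fun x => r.π (g x) (r.u x ξ)) μ := r.integrable μ hgi ξ
  calc ∫ x, r.π (convFun μ S f g x) (r.u x ξ) ∂μ
      = ∫ x, ∫ y, r.π (convIntegrand S f g x y) (r.u x ξ) ∂μ ∂μ := by
        congr 1 with x
        exact ((r.π.flip (r.u x ξ)).integral_comp_comm
          (integrable_convIntegrand_of_hasCompactSupport μ hf cf hg x)).symm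
    _ = ∫ y, ∫ x, r.π (convIntegrand S f g x y) (r.u x ξ) ∂μ ∂μ :=
        integral_integral_swap_of_hasCompactSupport hk hc
    _ = ∫ y, r.π (f y) (r.u y (∫ x, r.π (g x) (r.u x ξ) ∂μ)) ∂μ := by
        congr 1 with y
        -- Left invariance replaces `x` by `yx`, after which the integrand factors.
        rw [← integral_mul_left_eq_self (fun x => r.π (convIntegrand S f g x y) (r.u x ξ)) y]
        simp only [r.map_convIntegrand_mul]
        exact ((r.π (f y)).comp ((r.u y : r.E ≃L[ℂ] r.E) : r.E →L[ℂ] r.E)).integral_comp_comm hint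

end Representation

variable (S) in
/-- The twisted convolution of two integrable functions is given almost everywhere by an absolutely
convergent integral, is integrable, and is the sum in `L¹` of twisted convolutions of compactly
supported continuous functions. -/
theorem exists_hasSum_convFun {f g : G → A} {F H : ℕ → G → A}
    (hF : ∀ n, Continuous (F n)) (cF : ∀ n, HasCompactSupport (F n))
    (sF : Summable fun n => ∫ x, ‖F n x‖ ∂μ) (hFf : ∀ᵐ x ∂μ, HasSum (fun n => F n x) (f x))
    (hH : ∀ n, Continuous (H n)) (cH : ∀ n, HasCompactSupport (H n))
    (sH : Summable fun n => ∫ x, ‖H n x‖ ∂μ) (hHg : ∀ᵐ x ∂μ, HasSum (fun n => H n x) (g x)) :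
    (∀ᵐ x ∂μ, Integrable (convIntegrand S f g x) μ) ∧
    ∃ h : Integrable (convFun μ S f g) μ, HasSum (fun p : ℕ × ℕ =>
      (integrable_convFun_of_hasCompactSupport (S := S) μ (hF p.1) (cF p.1) (hH p.2)
        (cH p.2)).toL1 _) (h.toL1 _) := by
  have iF := fun n => (hF n).integrable_of_hasCompactSupport (μ := μ) (cF n)
  have iH := fun n => (hH n).integrable_of_hasCompactSupport (μ := μ) (cH n)
  have iconv := fun p : ℕ × ℕ => integrable_convFun_of_hasCompactSupport (S := S) μ
    (hF p.1) (cF p.1) (hH p.2) (cH p.2)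
  have inorm := fun p : ℕ × ℕ => integrable_normConv μ (hF p.1) (cF p.1) (hH p.2) (cH p.2)
  have snorm : Summable fun p : ℕ × ℕ => ∫ x, ‖normConv μ (F p.1) (H p.2) x‖ ∂μ := by
    simp only [Real.norm_of_nonneg (normConv_nonneg _ _ _ _)]
    refine (sF.mul_of_nonneg sH (fun _ => integral_nonneg fun _ => norm_nonneg _)
      fun _ => integral_nonneg fun _ => norm_nonneg _).congr fun p => ?_
    rw [integral_normConv μ (hF p.1) (cF p.1) (hH p.2) (cH p.2)]
  have sconv : Summable fun p : ℕ × ℕ => ∫ x, ‖convFun μ S (F p.1) (H p.2) x‖ ∂μ := by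
    refine snorm.of_nonneg_of_le (fun _ => integral_nonneg fun _ => norm_nonneg _) fun p => ?_
    refine integral_mono (iconv p).norm (inorm p).norm fun x => ?_
    exact (norm_convFun_le μ (hF _) (cF _) (hH _) x).trans (le_abs_self _)
  have hFf' := ae_summable_norm_of_summable_integral_norm iF sF
  have hHg' := hHg.and (ae_summable_norm_of_summable_integral_norm iH sH)
  -- Convergence of the expansion of `g` at `y⁻¹x` matters only where some `F n` is nonzero at `y`.
  -- Each `F n` has compact support, so nullity on compact sets is enough.
  have hnull : ∀ x, ∀ᵐ y ∂μ, ∀ n, F n y ≠ 0 →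
      HasSum (fun n => H n (y⁻¹ * x)) (g (y⁻¹ * x)) ∧ Summable fun n => ‖H n (y⁻¹ * x)‖ := by
    intro x
    refine ae_all_iff.2 fun n => ?_
    refine measure_mono_null (fun y hy => ?_)
      (measure_inter_preimage_inv_mul_eq_zero μ hHg' (cF n) x)
    simp only [Set.mem_compl_iff, Set.mem_ofPred_eq, Classical.not_imp] at hy
    exact ⟨subset_tsupport _ hy.1, hy.2⟩
  have hpt : ∀ x, ∀ᵐ y ∂μ, HasSum (fun p : ℕ × ℕ => convIntegrand S (F p.1) (H p.2) x y)
      (convIntegrand S f g x y) := by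
    intro x
    filter_upwards [hFf, hFf', hnull x] with y h1 h2 h3
    by_cases h0 : ∃ n, F n y ≠ 0
    · obtain ⟨n, hn⟩ := h0
      exact hasSum_convIntegrand S h1 h2 (h3 n hn).1 (h3 n hn).2
    · push Not at h0
      have hf0 : f y = 0 := by
        simp only [h0] at h1
        exact h1.unique hasSum_zero
      simp only [convIntegrand_of_left_eq_zero S hf0, convIntegrand_of_left_eq_zero S (h0 _)]
      exact hasSum_zero
  have hx : ∀ᵐ x ∂μ, Integrable (convIntegrand S f g x) μ ∧
      HasSum (fun p : ℕ × ℕ => convFun μ S (F p.1) (H p.2) x) (convFun μ S f g x) := by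
    -- For such `x` the dominating scalar series converges, so the integrands have summable
    -- `L¹`-norms in `y`, and the sum may be integrated term by term.
    filter_upwards [ae_summable_norm_of_summable_integral_norm inorm snorm] with x hx
    have i1 := fun p : ℕ × ℕ => integrable_convIntegrand_of_hasCompactSupport (S := S) μ
      (hF p.1) (cF p.1) (hH p.2) x
    have s1 : Summable fun p : ℕ × ℕ => ∫ y, ‖convIntegrand S (F p.1) (H p.2) x y‖ ∂μ := by
      refine hx.of_nonneg_of_le (fun _ => integral_nonneg fun _ => norm_nonneg _) fun p => ?_
      exact (integral_norm_convIntegrand_le μ (hF _) (cF _) (hH _) x).trans (le_abs_self _)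
    refine ⟨(exists_hasSum_toL1 i1 s1 (hpt x)).1, ?_⟩
    have h := hasSum_integral_of_summable_integral_norm i1 s1
    rwa [integral_congr_ae ((hpt x).mono fun y hy => hy.tsum_eq)] at h
  exact ⟨hx.mono fun x h => h.1, exists_hasSum_toL1 iconv sconv (hx.mono fun x h => h.2)⟩

variable (S) in
theorem integrable_convIntegrand_and_convFun (f g : Lp A 1 μ) :
    (∀ᵐ x ∂μ, Integrable (convIntegrand S f g x) μ) ∧ Integrable (convFun μ S f g) μ := by
  obtain ⟨F, hF, cF, sF, hFf⟩ := exists_series_hasCompactSupport (L1.integrable_coeFn f)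
  obtain ⟨H, hH, cH, sH, hHg⟩ := exists_series_hasCompactSupport (L1.integrable_coeFn g)
  obtain ⟨h1, h2, -⟩ := exists_hasSum_convFun μ S hF cF sF hFf hH cH sH hHg
  exact ⟨h1, h2⟩

/-- The integrated representation is multiplicative for the twisted convolution. -/
theorem CovariantRep.integrated_conv [HasCAI A] (r : CovariantRep.{uG, uA, uE} S)
    (f g : Lp A 1 μ) :
    r.integrated μ (conv μ S f g) = r.integrated μ f * r.integrated μ g := by
  obtain ⟨F, hF, cF, sF, hFf⟩ := exists_series_hasCompactSupport (L1.integrable_coeFn f)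
  obtain ⟨H, hH, cH, sH, hHg⟩ := exists_series_hasCompactSupport (L1.integrable_coeFn g)
  obtain ⟨-, h2, h3⟩ := exists_hasSum_convFun μ S hF cF sF hFf hH cH sH hHg
  have iF := fun n => (hF n).integrable_of_hasCompactSupport (μ := μ) (cF n)
  have iH := fun n => (hH n).integrable_of_hasCompactSupport (μ := μ) (cH n)
  obtain ⟨jF, kF⟩ := exists_hasSum_toL1 iF sF hFf
  obtain ⟨jH, kH⟩ := exists_hasSum_toL1 iH sH hHg
  rw [Integrable.toL1_coeFn] at kF kH
  have e : conv μ S f g = h2.toL1 _ := dif_pos h2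
  have h4 := (r.integrated μ).hasSum h3
  simp only [fun p : ℕ × ℕ => r.integrated_convFun_of_hasCompactSupport μ (hF p.1) (cF p.1)
    (hH p.2) (cH p.2) (iF p.1) (iH p.2)] at h4
  have h5 := (r.integrated μ).hasSum kF
  have h6 := (r.integrated μ).hasSum kH
  -- The summability required of the double series of operator products is inherited from the
  -- convergent series of convolutions.
  have h7 := h5.mul h6 h4.summable
  rw [e]
  exact h4.unique h7

end

/-! ### The Banach algebra structure of the completion. -/

section

universe uG uA uE

variable {G : Type uG} [Group G] [TopologicalSpace G] [IsTopologicalGroup G]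
  [LocallyCompactSpace G] [T2Space G] [MeasurableSpace G] [BorelSpace G]
  (μ : Measure G) [μ.IsHaarMeasure] [μ.Regular]
  {A : Type uA} [NonUnitalNormedRing A] [NormedSpace ℂ A] [SMulCommClass ℂ A A]
  [IsScalarTower ℂ A A] [CompleteSpace A] [HasCAI A]
  {S : TwistedAction G A} {R : Set (CovariantRep.{uG, uA, uE} S)} (hR : UniformlyBounded R)

section

omit [T2Space G] [μ.IsHaarMeasure] [CompleteSpace A]

theorem norm_toCrossedProduct_le {f : Lp A 1 μ} {c : ℝ} (hc : 0 ≤ c)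
    (h : ∀ r ∈ R, ‖r.integrated μ f‖ ≤ c) : ‖toCrossedProduct μ hR f‖ ≤ c := by
  rw [norm_toCrossedProduct]
  refine Real.sSup_le ?_ hc
  rintro _ ⟨r, hr, rfl⟩
  exact h r hr

/-- Elements are separated by the integrated forms. The algebra laws are therefore read off from
operators, and none has to be proved for twisted convolution on `L¹` itself. -/
theorem toCrossedProduct_eq {f g : Lp A 1 μ}
    (h : ∀ r ∈ R, r.integrated μ f = r.integrated μ g) :
    toCrossedProduct μ hR f = toCrossedProduct μ hR g := by
  rw [← sub_eq_zero, ← map_sub, ← norm_le_zero_iff]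
  refine norm_toCrossedProduct_le μ hR le_rfl fun r hr => ?_
  rw [map_sub, h r hr, sub_self, norm_zero]

theorem norm_integrated_le_norm_toCrossedProduct {r : CovariantRep.{uG, uA, uE} S} (hr : r ∈ R)
    (f : Lp A 1 μ) : ‖r.integrated μ f‖ ≤ ‖toCrossedProduct μ hR f‖ := by
  rw [norm_toCrossedProduct]
  exact le_crossedNorm μ hR hr f

include hR in
theorem bound_nonneg : 0 ≤ bound R :=
  Real.sSup_nonneg (by rintro _ ⟨r, -, rfl⟩; positivity)

include hR in
theorem norm_le_bound {r : CovariantRep.{uG, uA, uE} S} (hr : r ∈ R) : ‖r.π‖ ≤ bound R :=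
  le_csSup hR ⟨r, hr, rfl⟩

theorem norm_toCrossedProduct_le_bound_mul (f : Lp A 1 μ) :
    ‖toCrossedProduct μ hR f‖ ≤ bound R * ‖f‖ :=
  norm_toCrossedProduct_le μ hR (mul_nonneg (bound_nonneg hR) (norm_nonneg _)) fun r hr =>
    (r.norm_integrated_le μ f).trans (by gcongr; exact norm_le_bound hR hr)

end

theorem norm_toCrossedProduct_conv_le (f g : Lp A 1 μ) :
    ‖toCrossedProduct μ hR (conv μ S f g)‖ ≤
      ‖toCrossedProduct μ hR f‖ * ‖toCrossedProduct μ hR g‖ := by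
  refine norm_toCrossedProduct_le μ hR (by positivity) fun r hr => ?_
  rw [r.integrated_conv μ]
  refine (norm_mul_le _ _).trans ?_
  gcongr <;> exact norm_integrated_le_norm_toCrossedProduct μ hR hr _

/-- The twisted convolution as a bilinear map from `L¹(G; A)` to the crossed product. -/
noncomputable def convLinear : Lp A 1 μ →ₗ[ℂ] Lp A 1 μ →ₗ[ℂ] CrossedProduct μ hR :=
  LinearMap.mk₂ ℂ (fun f g => toCrossedProduct μ hR (conv μ S f g))
    (fun f f' g => by
      rw [← map_add]
      refine toCrossedProduct_eq μ hR fun r _ => ?_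
      simp only [map_add, r.integrated_conv μ, add_mul])
    (fun c f g => by
      rw [← map_smul]
      refine toCrossedProduct_eq μ hR fun r _ => ?_
      rw [map_smul, r.integrated_conv μ, r.integrated_conv μ, map_smul]
      rfl)
    (fun f g g' => by
      rw [← map_add]
      refine toCrossedProduct_eq μ hR fun r _ => ?_
      simp only [map_add, r.integrated_conv μ, mul_add])
    (fun c f g => by
      rw [← map_smul]
      refine toCrossedProduct_eq μ hR fun r _ => ?_
      rw [map_smul, r.integrated_conv μ, r.integrated_conv μ, map_smul]
      exact ContinuousLinearMap.ext fun ξ => map_smul (r.integrated μ f) c _)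

/-- `convLinear` as a bounded bilinear map on `L¹(G; A)` with the seminorm `‖·‖_R`. -/
noncomputable def convL :
    PreCrossedProduct μ hR →L[ℂ] PreCrossedProduct μ hR →L[ℂ] CrossedProduct μ hR :=
  LinearMap.mkContinuous₂ (E := PreCrossedProduct μ hR) (F := PreCrossedProduct μ hR)
    (convLinear μ hR) 1 (fun f g => by
      rw [one_mul, ← UniformSpace.Completion.norm_coe f, ← UniformSpace.Completion.norm_coe g]
      exact norm_toCrossedProduct_conv_le μ hR f g)

theorem continuous_toCrossedProduct_conv :
    Continuous fun p : PreCrossedProduct μ hR × PreCrossedProduct μ hR =>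
      toCrossedProduct μ hR (conv μ S p.1 p.2) :=
  (convL μ hR).continuous₂

/-- The product is defined as a bare extension from a dense subset, so its continuity needs proof;
it holds because a continuous biadditive map extends continuously to completions. -/
theorem continuous_mul_crossedProduct :
    Continuous fun p : CrossedProduct μ hR × CrossedProduct μ hR => p.1 * p.2 := by
  let φ : PreCrossedProduct μ hR →+ PreCrossedProduct μ hR →+ CrossedProduct μ hR :=
    { toFun := fun f => (convL μ hR f : PreCrossedProduct μ hR →+ CrossedProduct μ hR)
      map_zero' := by ext; simp
      map_add' := fun f g => by ext; simp }
  have de : IsDenseInducing (UniformSpace.Completion.toCompl (α := PreCrossedProduct μ hR)) :=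
    UniformSpace.Completion.isDenseInducing_coe
  exact IsDenseInducing.extend_Z_bilin de de (φ := φ) (continuous_toCrossedProduct_conv μ hR)

theorem toCrossedProduct_mul (f g : Lp A 1 μ) :
    toCrossedProduct μ hR f * toCrossedProduct μ hR g = toCrossedProduct μ hR (conv μ S f g) :=
  IsDenseInducing.extend_eq
    ((UniformSpace.Completion.isDenseInducing_coe (α := PreCrossedProduct μ hR)).prodMap
      (UniformSpace.Completion.isDenseInducing_coe (α := PreCrossedProduct μ hR)))
    (continuous_toCrossedProduct_conv μ hR) (f, g)

section Laws

variable {X : Type*} [TopologicalSpace X] {a b : X → CrossedProduct μ hR}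

theorem continuous_mul_comp (ha : Continuous a) (hb : Continuous b) :
    Continuous fun x => a x * b x :=
  (continuous_mul_crossedProduct μ hR).comp (ha.prodMk hb)

end Laws

theorem crossedProduct_add_mul (a b c : CrossedProduct μ hR) :
    (a + b) * c = a * c + b * c := by
  refine (denseRange_toCrossedProduct μ hR).induction_on₃
    (p := fun a b c => (a + b) * c = a * c + b * c) ?_ (fun f g h => ?_) a b c
  · refine isClosed_eq (continuous_mul_comp μ hR ?_ ?_)
      (.add (continuous_mul_comp μ hR ?_ ?_) (continuous_mul_comp μ hR ?_ ?_)) <;> fun_prop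
  · simp only [← map_add, toCrossedProduct_mul]
    rw [map_add]
    exact LinearMap.map_add₂ (convLinear μ hR) f g h

theorem crossedProduct_mul_add (a b c : CrossedProduct μ hR) :
    a * (b + c) = a * b + a * c := by
  refine (denseRange_toCrossedProduct μ hR).induction_on₃
    (p := fun a b c => a * (b + c) = a * b + a * c) ?_ (fun f g h => ?_) a b c
  · refine isClosed_eq (continuous_mul_comp μ hR ?_ ?_)
      (.add (continuous_mul_comp μ hR ?_ ?_) (continuous_mul_comp μ hR ?_ ?_)) <;> fun_prop
  · simp only [← map_add, toCrossedProduct_mul]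
    rw [map_add]
    exact map_add (convLinear μ hR f) g h

theorem crossedProduct_mul_assoc (a b c : CrossedProduct μ hR) : a * b * c = a * (b * c) := by
  refine (denseRange_toCrossedProduct μ hR).induction_on₃
    (p := fun a b c => a * b * c = a * (b * c)) ?_ (fun f g h => ?_) a b c
  · refine isClosed_eq (continuous_mul_comp μ hR (continuous_mul_comp μ hR ?_ ?_) ?_)
      (continuous_mul_comp μ hR ?_ (continuous_mul_comp μ hR ?_ ?_)) <;> fun_prop
  · simp only [toCrossedProduct_mul]
    refine toCrossedProduct_eq μ hR fun r _ => ?_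
    simp only [r.integrated_conv μ, mul_assoc]

theorem crossedProduct_smul_mul (z : ℂ) (a b : CrossedProduct μ hR) :
    (z • a) * b = z • (a * b) := by
  refine (denseRange_toCrossedProduct μ hR).induction_on₂
    (p := fun a b => (z • a) * b = z • (a * b)) ?_ (fun f g => ?_) a b
  · have hz : Continuous fun a : CrossedProduct μ hR => z • a := continuous_const_smul z
    exact isClosed_eq (continuous_mul_comp μ hR (hz.comp continuous_fst) continuous_snd)
      (hz.comp (continuous_mul_crossedProduct μ hR))
  · simp only [← map_smul, toCrossedProduct_mul]
    rw [map_smul]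
    exact LinearMap.map_smul₂ (convLinear μ hR) z f g

theorem crossedProduct_mul_smul (z : ℂ) (a b : CrossedProduct μ hR) :
    a * (z • b) = z • (a * b) := by
  refine (denseRange_toCrossedProduct μ hR).induction_on₂
    (p := fun a b => a * (z • b) = z • (a * b)) ?_ (fun f g => ?_) a b
  · have hz : Continuous fun a : CrossedProduct μ hR => z • a := continuous_const_smul z
    exact isClosed_eq (continuous_mul_comp μ hR continuous_fst (hz.comp continuous_snd))
      (hz.comp (continuous_mul_crossedProduct μ hR))
  · simp only [← map_smul, toCrossedProduct_mul]
    rw [map_smul]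
    exact map_smul (convLinear μ hR f) z g

theorem crossedProduct_norm_mul_le (a b : CrossedProduct μ hR) : ‖a * b‖ ≤ ‖a‖ * ‖b‖ := by
  refine (denseRange_toCrossedProduct μ hR).induction_on₂
    (p := fun a b => ‖a * b‖ ≤ ‖a‖ * ‖b‖) ?_ (fun f g => ?_) a b
  · exact isClosed_le (continuous_mul_crossedProduct μ hR).norm (by fun_prop)
  · rw [toCrossedProduct_mul]
    exact norm_toCrossedProduct_conv_le μ hR f g

end

/-! ### Approximate units for twisted convolution. -/

section

universe uG uA uE

/-- The net is indexed by pairs of a finite set and a natural number `n`, with tolerance `1 / (n +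
1)`. -/
theorem hasBoundedApproxIdentity_of_finset {B : Type*} [SeminormedAddCommGroup B] [Mul B] {C : ℝ}
    (h : ∀ (s : Finset B) (ε : ℝ), 0 < ε →
      ∃ e : B, ‖e‖ ≤ C ∧ ∀ b ∈ s, ‖e * b - b‖ ≤ ε ∧ ‖b * e - b‖ ≤ ε) :
    HasBoundedApproxIdentity B C := by
  classical
  choose e he hb using fun p : Finset B × ℕ => h p.1 (1 / ((p.2 : ℝ) + 1)) (by positivity)
  have key : ∀ (b : B) (F : Finset B × ℕ → ℝ), (∀ p, 0 ≤ F p) →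
      (∀ p : Finset B × ℕ, b ∈ p.1 → F p ≤ 1 / ((p.2 : ℝ) + 1)) → Tendsto F atTop (𝓝 0) := by
    intro b F hF0 hF
    have hlim : Tendsto (fun p : Finset B × ℕ => 1 / ((p.2 : ℝ) + 1)) atTop (𝓝 0) := by
      rw [← prod_atTop_atTop_eq]
      exact tendsto_one_div_add_atTop_nhds_zero_nat.comp tendsto_snd
    refine tendsto_of_tendsto_of_tendsto_of_le_of_le' tendsto_const_nhds hlim
      (Eventually.of_forall hF0) ?_
    filter_upwards [eventually_ge_atTop (({b}, 0) : Finset B × ℕ)] with p hp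
    exact hF p (hp.1 (Finset.mem_singleton_self b))
  exact ⟨Finset B × ℕ, inferInstance, inferInstance, inferInstance, e, he, fun b =>
    ⟨key b _ (fun _ => norm_nonneg _) fun p hp => (hb p b hp).1,
      key b _ (fun _ => norm_nonneg _) fun p hp => (hb p b hp).2⟩⟩

/-- Multiplications by elements of the unit ball are equicontinuous, so a finite `ε / 3`-net of `K`
suffices. -/
theorem exists_norm_mul_sub_le_of_isCompact {A : Type uA} [NonUnitalNormedRing A]
    [NormedSpace ℂ A] [HasCAI A] {K : Set A} (hK : IsCompact K) {ε : ℝ} (hε : 0 < ε) :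
    ∃ a : A, ‖a‖ ≤ 1 ∧ ∀ b ∈ K, ‖a * b - b‖ ≤ ε ∧ ‖b * a - b‖ ≤ ε := by
  obtain ⟨Λ, _, _, _, e, he, h⟩ := HasCAI.exists_cai (A := A)
  obtain ⟨t, -, ht, hKt⟩ := hK.finite_cover_balls (e := ε / 3) (by positivity)
  have hev : ∀ᶠ l in atTop, ∀ c ∈ t, ‖e l * c - c‖ < ε / 3 ∧ ‖c * e l - c‖ < ε / 3 :=
    (eventually_all_finite ht).2 fun c _ =>
      ((h c).1.eventually (gt_mem_nhds (by positivity))).and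
        ((h c).2.eventually (gt_mem_nhds (by positivity)))
  obtain ⟨l, hl⟩ := hev.exists
  refine ⟨e l, he l, fun b hb => ?_⟩
  obtain ⟨c, hc, hbc⟩ := Set.mem_iUnion₂.1 (hKt hb)
  rw [Metric.mem_ball, dist_eq_norm] at hbc
  have h1 : ‖e l * (b - c)‖ ≤ ‖b - c‖ := (norm_mul_le _ _).trans
    (mul_le_of_le_one_left (norm_nonneg _) (he l))
  have h2 : ‖(b - c) * e l‖ ≤ ‖b - c‖ := (norm_mul_le _ _).trans
    (mul_le_of_le_one_right (norm_nonneg _) (he l))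
  have h3 := hl c hc
  constructor
  · calc ‖e l * b - b‖ = ‖e l * (b - c) + (e l * c - c) - (b - c)‖ := by
          rw [mul_sub]; abel_nf
      _ ≤ ‖e l * (b - c)‖ + ‖e l * c - c‖ + ‖b - c‖ :=
          (norm_sub_le _ _).trans (by gcongr; exact norm_add_le _ _)
      _ ≤ ε := by linarith [h3.1]
  · calc ‖b * e l - b‖ = ‖(b - c) * e l + (c * e l - c) - (b - c)‖ := by
          rw [sub_mul]; abel_nf
      _ ≤ ‖(b - c) * e l‖ + ‖c * e l - c‖ + ‖b - c‖ :=
          (norm_sub_le _ _).trans (by gcongr; exact norm_add_le _ _)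
      _ ≤ ε := by linarith [h3.2]

variable {G : Type uG} [Group G] [TopologicalSpace G] [IsTopologicalGroup G]
  [LocallyCompactSpace G] [T2Space G] [MeasurableSpace G] [BorelSpace G]
  (μ : Measure G) [μ.IsHaarMeasure] [μ.Regular]

/-- There are symmetric normalised bump functions supported in every neighbourhood of `1`. -/
theorem exists_symmetric_bump {U : Set G} (hU : U ∈ 𝓝 (1 : G)) :
    ∃ φ : G → ℝ, Continuous φ ∧ HasCompactSupport φ ∧ (∀ y, 0 ≤ φ y) ∧ (∀ y, φ y⁻¹ = φ y) ∧
      (∀ y, φ y ≠ 0 → y ∈ U) ∧ ∫ y, φ y ∂μ = 1 := by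
  -- The bump `f` lives in `U ∩ U⁻¹`, so its symmetrisation `f(y) + f(y⁻¹)` still vanishes off `U`.
  have hW : U ∩ U⁻¹ ∈ 𝓝 (1 : G) := inter_mem hU (inv_mem_nhds_one G hU)
  obtain ⟨f, hf1, hf0, cf, hf⟩ := exists_continuous_one_zero_of_isCompact
    (isCompact_singleton (x := (1 : G))) isOpen_interior.isClosed_compl
    (Set.disjoint_compl_right_iff_subset.2
      (Set.singleton_subset_iff.2 (mem_interior_iff_mem_nhds.2 hW)))
  have cf' : HasCompactSupport fun y => f y⁻¹ := cf.comp_homeomorph (Homeomorph.inv G)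
  have hψ : Continuous fun y => f y + f y⁻¹ := by fun_prop
  have cψ : HasCompactSupport fun y => f y + f y⁻¹ := cf.add cf'
  have hψ0 : ∀ y, 0 ≤ f y + f y⁻¹ := fun y => add_nonneg (hf y).1 (hf y⁻¹).1
  have hc : 0 < ∫ y, f y + f y⁻¹ ∂μ :=
    hψ.integral_pos_of_hasCompactSupport_nonneg_nonzero (x := 1) cψ hψ0
      (by simp [hf1 (Set.mem_singleton (1 : G))])
  refine ⟨fun y => (f y + f y⁻¹) * (∫ y, f y + f y⁻¹ ∂μ)⁻¹, by fun_prop, cψ.mul_right,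
    fun y => mul_nonneg (hψ0 y) (inv_nonneg.2 hc.le), fun y => by beta_reduce; rw [inv_inv, add_comm (f y⁻¹)],
    fun y hy => ?_, ?_⟩
  · by_contra hyU
    have h0 : ∀ z, z ∉ U ∩ U⁻¹ → f z = 0 := fun z hz => hf0 fun h => hz (interior_subset h)
    refine hy ?_
    beta_reduce
    rw [h0 y fun h => hyU h.1, h0 y⁻¹ fun h => hyU (by simpa using h.2), add_zero, zero_mul]
  · rw [integral_mul_const, mul_inv_cancel₀ hc.ne']

/-- An average against a probability density stays within `c` of `b` if the values on the support
do. -/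
theorem norm_integral_smul_sub_le {E : Type*} [NormedAddCommGroup E] [NormedSpace ℝ E]
    [CompleteSpace E] {φ : G → ℝ} (hφ : Continuous φ) (cφ : HasCompactSupport φ)
    (φ0 : ∀ y, 0 ≤ φ y) (φ1 : ∫ y, φ y ∂μ = 1) {k : G → E} (hk : Continuous k) {b : E} {c : ℝ}
    (h : ∀ y, φ y ≠ 0 → ‖k y - b‖ ≤ c) : ‖∫ y, φ y • k y ∂μ - b‖ ≤ c := by
  have i1 : Integrable φ μ := hφ.integrable_of_hasCompactSupport cφ
  have i2 : Integrable (fun y => φ y • k y) μ :=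
    (hφ.smul hk).integrable_of_hasCompactSupport cφ.smul_right
  have hb : b = ∫ y, φ y • b ∂μ := by rw [integral_smul_const, φ1, one_smul]
  nth_rewrite 1 [hb]
  rw [← integral_sub i2 (i1.smul_const b)]
  calc ‖∫ y, (φ y • k y - φ y • b) ∂μ‖ ≤ ∫ y, φ y * c ∂μ := by
        refine norm_integral_le_of_norm_le (i1.mul_const c) (Eventually.of_forall fun y => ?_)
        rw [← smul_sub, norm_smul, Real.norm_of_nonneg (φ0 y)]
        rcases eq_or_ne (φ y) 0 with h0 | h0
        · simp [h0]
        · exact mul_le_mul_of_nonneg_left (h y h0) (φ0 y)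
    _ = c := by rw [integral_mul_const, φ1, one_mul]

variable {A : Type uA} [NonUnitalNormedRing A] [NormedSpace ℂ A] [SMulCommClass ℂ A A]
  [IsScalarTower ℂ A A] [CompleteSpace A] [HasCAI A] {S : TwistedAction G A}

omit [LocallyCompactSpace G] [T2Space G] [MeasurableSpace G] [BorelSpace G] [CompleteSpace A]
  [IsTopologicalGroup G] in
theorem convIntegrand_smul_left (φ : G → ℝ) (a : A) (f : G → A) (x y : G) :
    convIntegrand S (fun y => (φ y : ℂ) • a) f x y =
      φ y • (a * (S.σ y (y⁻¹ * x) : 𝓜(ℂ, A)).snd (S.α y (f (y⁻¹ * x)))) := by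
  unfold convIntegrand
  rw [smul_mul_assoc, map_smul, snd_mul_apply, Complex.coe_smul]

-- Evaluating at `x * y` puts the bump at `y⁻¹`, close to `1`, independently of `x`.
omit [LocallyCompactSpace G] [T2Space G] [MeasurableSpace G] [BorelSpace G] [CompleteSpace A]
  [IsTopologicalGroup G] in
theorem convIntegrand_smul_right (φ : G → ℝ) (a : A) (f : G → A) (x y : G) :
    convIntegrand S f (fun y => (φ y : ℂ) • a) x (x * y) =
      φ y⁻¹ • (S.σ (x * y) y⁻¹ : 𝓜(ℂ, A)).snd (f (x * y) * S.α (x * y) a) := by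
  have h : (x * y)⁻¹ * x = y⁻¹ := by group
  unfold convIntegrand
  rw [h, map_smul, mul_smul_comm, map_smul, Complex.coe_smul]

theorem integral_norm_sub_le_of_indicator {E : Type*} [NormedAddCommGroup E] {f : G → E}
    (hf : Integrable f μ) {K : Set G} (hK : IsCompact K) {c : ℝ} (h : ∀ x ∈ K, ‖f x‖ ≤ c)
    (h0 : ∀ x, x ∉ K → f x = 0) : ∫ x, ‖f x‖ ∂μ ≤ μ.real K * c := by
  calc ∫ x, ‖f x‖ ∂μ ≤ ∫ x, K.indicator (fun _ => c) x ∂μ := by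
        refine integral_mono hf.norm ((integrable_indicator_iff hK.measurableSet).2
          (integrableOn_const hK.measure_lt_top.ne)) fun x => ?_
        by_cases hx : x ∈ K
        · simpa [hx] using h x hx
        · simp [hx, h0 x hx]
    _ = μ.real K * c := by
        rw [integral_indicator hK.measurableSet, setIntegral_const, smul_eq_mul]

variable (S) in
/-- Finitely many compactly supported continuous functions have a common approximate two-sided unit
for the twisted convolution. -/
theorem exists_approx_unit_convFun {ι : Type*} [Finite ι] {f : ι → G → A}
    (hf : ∀ i, Continuous (f i)) (cf : ∀ i, HasCompactSupport (f i)) {ε : ℝ} (hε : 0 < ε) :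
    ∃ e : G → A, Continuous e ∧ HasCompactSupport e ∧ ∫ x, ‖e x‖ ∂μ ≤ 1 ∧
      ∀ i, ∫ x, ‖convFun μ S e (f i) x - f i x‖ ∂μ ≤ ε ∧
        ∫ x, ‖convFun μ S (f i) e x - f i x‖ ∂μ ≤ ε := by
  obtain ⟨V, hV, hV1⟩ := exists_compact_mem_nhds (1 : G)
  let K : Set G := ⋃ i, tsupport (f i)
  have hK : IsCompact K := isCompact_iUnion fun i => cf i
  have hfK : ∀ i x, f i x ≠ 0 → x ∈ K := fun i x h =>
    Set.mem_iUnion.2 ⟨i, subset_tsupport _ h⟩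
  -- `L` contains `V K` and `K V⁻¹`; with bumps supported in `V`, both convolutions and all `f i`
  -- vanish off `L`.
  let L : Set G := (fun p : G × G => p.1 * p.2) '' (V ×ˢ K) ∪
    (fun p : G × G => p.1 * p.2⁻¹) '' (K ×ˢ V)
  have hL : IsCompact L := ((hV.prod hK).image (by fun_prop)).union
    ((hK.prod hV).image (by fun_prop))
  have hL1 : ∀ i x y, y ∈ V → x ∉ L → f i (y⁻¹ * x) = 0 := fun i x y hy hx => by
    by_contra h
    exact hx (Or.inl ⟨(y, y⁻¹ * x), ⟨hy, hfK i _ h⟩, by simp⟩)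
  have hL2 : ∀ i x y, y ∈ V → x ∉ L → f i (x * y) = 0 := fun i x y hy hx => by
    by_contra h
    exact hx (Or.inr ⟨(x * y, y), ⟨hfK i _ h, hy⟩, by simp⟩)
  have hL0 : ∀ i x, x ∉ L → f i x = 0 := fun i x hx => by
    simpa using hL2 i x 1 (mem_of_mem_nhds hV1) hx
  obtain ⟨η, hη, hηε⟩ : ∃ η : ℝ, 0 < η ∧ μ.real L * (η + η) ≤ ε := by
    have h0 : 0 ≤ μ.real L := measureReal_nonneg
    refine ⟨ε / (2 * (μ.real L + 1)), by positivity, ?_⟩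
    rw [← add_div, mul_div_assoc', div_le_iff₀ (by positivity)]
    nlinarith
  have hP : ∀ i, Continuous fun p : G × G =>
      (S.σ p.1 (p.1⁻¹ * p.2) : 𝓜(ℂ, A)).snd (S.α p.1 (f i (p.1⁻¹ * p.2))) := fun i =>
    TwistedAction.continuous_σ_snd_comp (by fun_prop) (by fun_prop)
      (TwistedAction.continuous_α_comp (by fun_prop) ((hf i).comp (by fun_prop)))
  have hQ : ∀ i, Continuous fun p : G × G =>
      (S.σ (p.2 * p.1) p.1⁻¹ : 𝓜(ℂ, A)).snd (f i (p.2 * p.1)) := fun i =>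
    TwistedAction.continuous_σ_snd_comp (by fun_prop) (by fun_prop) ((hf i).comp (by fun_prop))
  -- At `y = 1` both differences vanish, by the normalisations of `α` and `σ`. Joint continuity and
  -- compactness of `L` make them small for `y` near `1`, uniformly in `x`.
  have hU : ∀ᶠ y in 𝓝 (1 : G), y ∈ V ∧ ∀ i, ∀ x ∈ L,
      ‖(S.σ y (y⁻¹ * x) : 𝓜(ℂ, A)).snd (S.α y (f i (y⁻¹ * x))) - f i x‖ < η ∧
      ‖(S.σ (x * y) y⁻¹ : 𝓜(ℂ, A)).snd (f i (x * y)) - f i x‖ < η := by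
    refine Filter.Eventually.and hV1 (eventually_all.2 fun i => ?_)
    refine hL.eventually_forall_of_forall_eventually fun x _ => ?_
    have hfs : Continuous fun p : G × G => f i p.2 := (hf i).comp continuous_snd
    refine Filter.Eventually.and
      (((hP i).sub hfs).norm.continuousAt.eventually (gt_mem_nhds ?_))
      (((hQ i).sub hfs).norm.continuousAt.eventually (gt_mem_nhds ?_))
    · simpa [S.σ_one_left, S.α_one] using hη
    · simpa [S.σ_one_right] using hη
  obtain ⟨φ, hφ, cφ, φ0, φs, φU, φ1⟩ := exists_symmetric_bump μ hU
  -- In `f * e` the unit occurs as `α_z(a)` with varying `z`. Since `‖f(z) α_z(a) - f(z)‖ =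
  -- ‖α_z⁻¹(f(z)) a - α_z⁻¹(f(z))‖`, it is enough that `a` also be an approximate unit for the
  -- compact set of all `α_z⁻¹(f(z))`.
  have hKA : IsCompact (⋃ i, (f i '' K ∪ (fun z => (S.α z).symm (f i z)) '' K)) :=
    isCompact_iUnion fun i => (hK.image (hf i)).union
      (hK.image (TwistedAction.continuous_α_symm_comp continuous_id (hf i)))
  obtain ⟨a, ha, haK⟩ := exists_norm_mul_sub_le_of_isCompact hKA hη
  have ha1 : ∀ i x, ‖a * f i x - f i x‖ ≤ η := fun i x => by
    by_cases h : f i x = 0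
    · simpa [h] using hη.le
    · exact (haK _ (Set.mem_iUnion.2 ⟨i, Or.inl ⟨x, hfK i x h, rfl⟩⟩)).1
  have ha2 : ∀ i z, ‖f i z * S.α z a - f i z‖ ≤ η := fun i z => by
    by_cases h : f i z = 0
    · simpa [h] using hη.le
    · have := (haK _ (Set.mem_iUnion.2 ⟨i, Or.inr ⟨z, hfK i z h, rfl⟩⟩)).2
      rw [← (S.α z).norm_map, map_sub, S.α_mul] at this
      simpa using this
  have he : Continuous fun y => (φ y : ℂ) • a := by fun_prop
  have ce : HasCompactSupport fun y => (φ y : ℂ) • a :=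
    cφ.mono fun y hy h => hy (by simp [show φ y = 0 from h])
  refine ⟨fun y => (φ y : ℂ) • a, he, ce, ?_, fun i => ⟨?_, ?_⟩⟩
  · calc ∫ x, ‖(φ x : ℂ) • a‖ ∂μ = ∫ x, φ x * ‖a‖ ∂μ := by
          congr 1 with x
          rw [norm_smul, Complex.norm_of_nonneg (φ0 x)]
      _ = ‖a‖ := by rw [integral_mul_const, φ1, one_mul]
      _ ≤ 1 := ha
  · refine (integral_norm_sub_le_of_indicator μ
      ((integrable_convFun_of_hasCompactSupport μ he ce (hf i) (cf i)).sub
        ((hf i).integrable_of_hasCompactSupport (cf i))) hL (fun x hx => ?_)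
        fun x hx => ?_).trans hηε
    · rw [Pi.sub_apply, convFun]
      simp only [convIntegrand_smul_left]
      refine norm_integral_smul_sub_le μ hφ cφ φ0 φ1
        (continuous_const.mul ((hP i).comp (Continuous.prodMk_left x))) fun y hy => ?_
      have h1 := ((φU y hy).2 i x hx).1
      calc _ = ‖a * ((S.σ y (y⁻¹ * x) : 𝓜(ℂ, A)).snd (S.α y (f i (y⁻¹ * x))) - f i x) +
            (a * f i x - f i x)‖ := by rw [mul_sub]; simp
        _ ≤ 1 * ‖(S.σ y (y⁻¹ * x) : 𝓜(ℂ, A)).snd (S.α y (f i (y⁻¹ * x))) - f i x‖ + η :=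
            (norm_add_le _ _).trans (add_le_add ((norm_mul_le _ _).trans (by gcongr)) (ha1 i x))
        _ ≤ η + η := by rw [one_mul]; gcongr
    · rw [Pi.sub_apply, convFun]
      simp only [convIntegrand_smul_left, hL0 i x hx, sub_zero]
      refine integral_eq_zero_of_ae (Eventually.of_forall fun y => ?_)
      by_cases hy : φ y = 0
      · simp [hy]
      · simp [hL1 i x y (φU y hy).1 hx]
  · refine (integral_norm_sub_le_of_indicator μ
      ((integrable_convFun_of_hasCompactSupport μ (hf i) (cf i) he ce).sub
        ((hf i).integrable_of_hasCompactSupport (cf i))) hL (fun x hx => ?_)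
        fun x hx => ?_).trans hηε
    · rw [Pi.sub_apply, convFun, ← integral_mul_left_eq_self _ x]
      simp only [convIntegrand_smul_right, φs]
      refine norm_integral_smul_sub_le μ hφ cφ φ0 φ1
        (TwistedAction.continuous_σ_snd_comp (by fun_prop) (by fun_prop)
          (((hf i).comp (continuous_const_mul x)).mul
            (TwistedAction.continuous_α_comp (by fun_prop) continuous_const))) fun y hy => ?_
      have h1 := ((φU y hy).2 i x hx).2
      calc _ = ‖(S.σ (x * y) y⁻¹ : 𝓜(ℂ, A)).snd (f i (x * y) * S.α (x * y) a - f i (x * y)) +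
            ((S.σ (x * y) y⁻¹ : 𝓜(ℂ, A)).snd (f i (x * y)) - f i x)‖ := by
              rw [map_sub]; simp
        _ ≤ η + η := (norm_add_le _ _).trans
            (add_le_add ((S.norm_σ_snd_le _ _ _).trans (ha2 i _)) h1.le)
    · rw [Pi.sub_apply, convFun, ← integral_mul_left_eq_self _ x]
      simp only [convIntegrand_smul_right, φs, hL0 i x hx, sub_zero]
      refine integral_eq_zero_of_ae (Eventually.of_forall fun y => ?_)
      by_cases hy : φ y = 0
      · simp [hy]
      · simp [hL2 i x y (φU y hy).1 hx]

end

/-! ### The bounded approximate identity of the crossed product. -/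

section

universe uG uA uE

variable {G : Type uG} [Group G] [TopologicalSpace G] [IsTopologicalGroup G]
  [LocallyCompactSpace G] [T2Space G] [MeasurableSpace G] [BorelSpace G]
  (μ : Measure G) [μ.IsHaarMeasure] [μ.Regular]
  {A : Type uA} [NonUnitalNormedRing A] [NormedSpace ℂ A] [SMulCommClass ℂ A A]
  [IsScalarTower ℂ A A] [CompleteSpace A] [HasCAI A]
  {S : TwistedAction G A} {R : Set (CovariantRep.{uG, uA, uE} S)} (hR : UniformlyBounded R)

/-- `conv` is formed from chosen representatives of the `L¹`-classes. Comparing integrated forms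
avoids checking that it does not depend on them. -/
theorem toCrossedProduct_mul_toL1 {f g : G → A} (hf : Continuous f) (cf : HasCompactSupport f)
    (hg : Continuous g) (cg : HasCompactSupport g) (hfi : Integrable f μ) (hgi : Integrable g μ)
    (hfg : Integrable (convFun μ S f g) μ) :
    toCrossedProduct μ hR (hfi.toL1 f) * toCrossedProduct μ hR (hgi.toL1 g) =
      toCrossedProduct μ hR (hfg.toL1 _) := by
  rw [toCrossedProduct_mul]
  refine toCrossedProduct_eq μ hR fun r _ => ?_
  rw [r.integrated_conv μ, r.integrated_convFun_of_hasCompactSupport μ hf cf hg cg hfi hgi hfg]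

theorem norm_toCrossedProduct_toL1_sub_le {f g : G → A} (hf : Integrable f μ)
    (hg : Integrable g μ) :
    ‖toCrossedProduct μ hR (hf.toL1 f) - toCrossedProduct μ hR (hg.toL1 g)‖ ≤
      bound R * ∫ x, ‖f x - g x‖ ∂μ := by
  rw [← map_sub, ← Integrable.toL1_sub]
  refine (norm_toCrossedProduct_le_bound_mul μ hR _).trans_eq ?_
  rw [L1.norm_of_fun_eq_integral_norm]
  rfl

theorem exists_norm_sub_toCrossedProduct_lt (b : CrossedProduct μ hR) {δ : ℝ} (hδ : 0 < δ) :
    ∃ (g : G → A) (_ : Continuous g) (_ : HasCompactSupport g) (hg : Integrable g μ),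
      ‖b - toCrossedProduct μ hR (hg.toL1 g)‖ < δ := by
  obtain ⟨f, hf⟩ := (denseRange_toCrossedProduct μ hR).exists_dist_lt b (half_pos hδ)
  have hC := bound_nonneg hR
  -- `bound R` may be zero, so the tolerance is divided by `bound R + 1`.
  have hpos : 0 < bound R + 1 := by positivity
  obtain ⟨g, hg, cg, ig, hlt⟩ := exists_hasCompactSupport_norm_sub_lt f
    (ε := δ / 2 / (bound R + 1)) (by positivity)
  refine ⟨g, hg, cg, ig, ?_⟩
  have h1 : ‖toCrossedProduct μ hR f - toCrossedProduct μ hR (ig.toL1 g)‖ ≤ δ / 2 := by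
    rw [← map_sub]
    refine (norm_toCrossedProduct_le_bound_mul μ hR _).trans ?_
    calc bound R * ‖f - ig.toL1 g‖ ≤ (bound R + 1) * (δ / 2 / (bound R + 1)) := by
          gcongr
          linarith
      _ = δ / 2 := by field_simp
  rw [dist_eq_norm] at hf
  calc _ ≤ ‖b - toCrossedProduct μ hR f‖ +
        ‖toCrossedProduct μ hR f - toCrossedProduct μ hR (ig.toL1 g)‖ :=
        norm_sub_le_norm_sub_add_norm_sub _ _ _
    _ < δ := by linarith

theorem hasBoundedApproxIdentity_crossedProduct :
    HasBoundedApproxIdentity (CrossedProduct μ hR) (bound R) := by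
  refine hasBoundedApproxIdentity_of_finset fun s ε hε => ?_
  have hC := bound_nonneg hR
  -- With `c` the approximation of `b` and `u` the unit, the three terms bound `u(b - c)`, `uc - c`
  -- and `b - c`; the same constants serve for multiplication by `u` on the right.
  obtain ⟨δ, hδ, hδε⟩ : ∃ δ : ℝ, 0 < δ ∧ bound R * δ + bound R * δ + δ ≤ ε := by
    refine ⟨ε / (2 * bound R + 1), by positivity, le_of_eq ?_⟩
    field_simp
    ring
  choose f hf cf jf hbf using fun b : s => exists_norm_sub_toCrossedProduct_lt μ hR b.1 hδ
  obtain ⟨e, he, ce, he1, hef⟩ := exists_approx_unit_convFun μ S hf cf hδ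
  have je : Integrable e μ := he.integrable_of_hasCompactSupport ce
  have hE : ‖toCrossedProduct μ hR (je.toL1 e)‖ ≤ bound R := by
    refine (norm_toCrossedProduct_le_bound_mul μ hR _).trans ?_
    rw [L1.norm_of_fun_eq_integral_norm]
    exact mul_le_of_le_one_right hC he1
  refine ⟨toCrossedProduct μ hR (je.toL1 e), hE, fun b hb => ?_⟩
  obtain ⟨h1, h2⟩ := hef ⟨b, hb⟩
  have h0 := (hbf ⟨b, hb⟩).le
  have ief := integrable_convFun_of_hasCompactSupport (S := S) μ he ce (hf ⟨b, hb⟩) (cf ⟨b, hb⟩)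
  have ife := integrable_convFun_of_hasCompactSupport (S := S) μ (hf ⟨b, hb⟩) (cf ⟨b, hb⟩) he ce
  have k1 := norm_toCrossedProduct_toL1_sub_le μ hR ief (jf ⟨b, hb⟩)
  have k2 := norm_toCrossedProduct_toL1_sub_le μ hR ife (jf ⟨b, hb⟩)
  rw [← toCrossedProduct_mul_toL1 μ hR he ce (hf ⟨b, hb⟩) (cf ⟨b, hb⟩) je (jf ⟨b, hb⟩)] at k1
  rw [← toCrossedProduct_mul_toL1 μ hR (hf ⟨b, hb⟩) (cf ⟨b, hb⟩) he ce (jf ⟨b, hb⟩) je] at k2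
  generalize toCrossedProduct μ hR (je.toL1 e) = u at *
  generalize toCrossedProduct μ hR ((jf ⟨b, hb⟩).toL1 (f ⟨b, hb⟩)) = c at *
  have l1 : ‖u * (b - c)‖ ≤ bound R * δ :=
    (crossedProduct_norm_mul_le μ hR _ _).trans (by gcongr)
  have l2 : ‖(b - c) * u‖ ≤ bound R * δ := by
    rw [mul_comm (bound R)]
    exact (crossedProduct_norm_mul_le μ hR _ _).trans (by gcongr)
  have m1 : u * (b - c) + u * c = u * b := by
    rw [← crossedProduct_mul_add, sub_add_cancel]
  have m2 : (b - c) * u + c * u = b * u := by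
    rw [← crossedProduct_add_mul, sub_add_cancel]
  constructor
  · calc ‖u * b - b‖ = ‖u * (b - c) + (u * c - c) - (b - c)‖ := by rw [← m1]; abel_nf
      _ ≤ ‖u * (b - c)‖ + ‖u * c - c‖ + ‖b - c‖ :=
          (norm_sub_le _ _).trans (by gcongr; exact norm_add_le _ _)
      _ ≤ bound R * δ + bound R * δ + δ := by
          gcongr
          exact k1.trans (by gcongr)
      _ ≤ ε := hδε
  · calc ‖b * u - b‖ = ‖(b - c) * u + (c * u - c) - (b - c)‖ := by rw [← m2]; abel_nf
      _ ≤ ‖(b - c) * u‖ + ‖c * u - c‖ + ‖b - c‖ :=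
          (norm_sub_le _ _).trans (by gcongr; exact norm_add_le _ _)
      _ ≤ bound R * δ + bound R * δ + δ := by
          gcongr
          exact k2.trans (by gcongr)
      _ ≤ ε := hδε

end

end TwistedCP

theorem mainTheorem4 {G : Type*} [Group G] [TopologicalSpace G] [IsTopologicalGroup G]
    [LocallyCompactSpace G] [T2Space G] [MeasurableSpace G] [BorelSpace G]
    (μ : Measure G) [μ.IsHaarMeasure] [μ.Regular]
    {A : Type*} [NonUnitalNormedRing A] [NormedSpace ℂ A] [SMulCommClass ℂ A A]
    [IsScalarTower ℂ A A] [CompleteSpace A] [HasCAI A]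
    (S : TwistedAction G A) (R : Set (CovariantRep S)) (hne : R.Nonempty)
    (hR : UniformlyBounded R) :
    -- the twisted convolution is well defined on `L¹(G; A)`
    (∀ f g : Lp A 1 μ, (∀ᵐ x ∂μ, Integrable (convIntegrand S f g x) μ) ∧
      Integrable (convFun μ S f g) μ) ∧
    -- its extension makes `F_R(G, A, α, σ)` a Banach algebra
    (∀ f g : Lp A 1 μ, toCrossedProduct μ hR f * toCrossedProduct μ hR g =
      toCrossedProduct μ hR (conv μ S f g)) ∧
    (∀ a b c : CrossedProduct μ hR, (a + b) * c = a * c + b * c ∧ a * (b + c) = a * b + a * c ∧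
      a * b * c = a * (b * c)) ∧
    (∀ (z : ℂ) (a b : CrossedProduct μ hR), (z • a) * b = z • (a * b) ∧ a * (z • b) = z • (a * b)) ∧
    (∀ a b : CrossedProduct μ hR, ‖a * b‖ ≤ ‖a‖ * ‖b‖) ∧
    -- it has a `C_R`-bounded approximate identity
    HasBoundedApproxIdentity (CrossedProduct μ hR) (bound R) := by
  exact ⟨fun f g => integrable_convIntegrand_and_convFun μ S f g, toCrossedProduct_mul μ hR,
    fun a b c => ⟨crossedProduct_add_mul μ hR a b c, crossedProduct_mul_add μ hR a b c,
      crossedProduct_mul_assoc μ hR a b c⟩,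
    fun z a b => ⟨crossedProduct_smul_mul μ hR z a b, crossedProduct_mul_smul μ hR z a b⟩,
    crossedProduct_norm_mul_le μ hR, hasBoundedApproxIdentity_crossedProduct μ hR⟩
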